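/- Let $m_1,m_2,m_3>0$ and $\alpha>0$. Consider three bodies in the plane $E=\mathbb{R}^2\cong\mathbb{C}$ with masses $m_i$, centre of mass $0$ and potential function $U(x)=\sum_{i<j} m_im_j|x_i-x_j|^{-\alpha}$. Let $\mathbb{T}$ be the time circle of length $2\pi$, let $\Lambda$ be the space of $H^1$ loops $x=(x_1,x_2,x_3):\mathbb{T}\to E^3$ with $\sum_i m_ix_i=0$, and let $\mathcal{A}_0(x)=\int_{\mathbb{T}}\big(\tfrac12\sum_i m_i|\dot x_i|^2+U(x)\big)\,dt\in[0,\infty]$ be the Lagrangian action functional. A symmetry group is a finite group $G$ with homomorphisms $\tau,\rho:G\to O(2)$ (acting on $\mathbb{T}$ and on $E$) and $\sigma:G\to\Sigma_3$ (acting on the indices) such that $m_{\sigma(g)(i)}=m_i$ for all $g,i$. It acts on loops by $(gx)_i(t)=\rho(g)\,x_{\sigma(g)^{-1}(i)}(\tau(g)^{-1}t)$, and $\Lambda^G$ denotes the set of loops in $\Lambda$ fixed by $G$ (equivariant loops). The group $G$ is called - bound to collisions if for every $x\in\Lambda^G$ there are $t\in\mathbb{T}$ and $i\neq j$ with $x_i(t)=x_j(t)$;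 - of type R if $\det\rho(g)=\det\tau(g)$ for all $g\in G$; - coercive if $\mathcal{A}_0(x)\to\infty$ as $\|x\|_{H^1}\to\infty$ in $\Lambda^G$; - fully uncoercive if it is neither of type R nor coercive; - homographic if every $x\in\Lambda^G$ is constant up to similarity, i.e. $x_i(t)=z(t)\xi_i$ for some complex-valued function $z$ on $\mathbb{T}$ and some $\xi\in\mathbb{C}^3$. For $g\in G$ let $\delta(g)$ be the angle such that $\tau(g)$ is $t\mapsto t+\delta(g)$ or $t\mapsto -t+\delta(g)$. If $G$ is of type R, the change to the frame rotating with angular velocity $\omega\in\mathbb{Z}$, i.e. $x(t)=e^{i\omega t}q(t)$, replaces $\rho(g)$ by $e^{-i\omega\delta(g)}\rho(g)$ and keeps $\tau$ and $\sigma$. The reduced group of $G$ is the quotient of $G$ by the normal subgroup $R=\{g:\det\tau(g)=1,\ \rho(g)=1,\ \sigma(g)=1\}$ of redundant or trivially acting elements, with the induced actions on $E$, on the indices, and on the circle $\mathbb{T}/\tau(R)$, which is rescaled to length $2\pi$; it is a subgroup of $O(2)\times O(2)\times\Sigma_3$. **Theorem.** Let $G$ be a symmetry group. Then $G$ is bound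 to collisions, or fully uncoercive, or homographic, or else, possibly after a change of rotating frame (if $G$ is of type R), its reduced group is conjugate in $O(2)\times O(2)\times\Sigma_3$ to one of the following ten groups. Here elements are written $(\tau,\rho,\sigma)$, $R_\theta$ is the rotation by $\theta$, and $s$ is the reflection along the first axis (so $s$ acts on time as $t\mapsto-t$). 1. Trivial: the group of order $1$. 2. Line: generated by $(s,s,())$, of order $2$. 3. $2$-$1$-choreography: generated by $(R_\pi,1,(1,2))$, of order $2$. 4. Isosceles: generated by $(s,s,(1,2))$, of order $2$. 5. Hill: generated by $(R_\pi,1,(1,2))$ and $(s,s,())$, of order $4$. 6. $3$-choreography: generated by $(R_{2\pi/3},1,(1,2,3))$, of order $3$. 7. Lagrange: generated by $(R_{2\pi/3},1,(1,2,3))$ and $(s,s,(1,2))$, of order $6$. 8. $C_6$: generated by $r=(R_{\pi/3},s,(1,2,3))$, of order $6$. 9. $D_6$: generated by $r^2$ and $h=(s,-1,(1,2))$, of order $6$. 10. $D_{12}$: generated by $r$ and $h$, of order $12$. -/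

import Mathlib

open MeasureTheory
open scoped ENNReal NNReal

noncomputable section

namespace ThreeBody

/-- The orthogonal group `O(2)` of the plane `E = ℝ² = ℂ`. It acts on `E`, and by restriction on
the time circle, which is the unit circle of `ℂ`. -/
abbrev O2 : Type := ℂ ≃ₗᵢ[ℝ] ℂ

/-- The group `Σ₃` of permutations of the three bodies (indexed by `0, 1, 2`). -/
abbrev Perm3 : Type := Equiv.Perm (Fin 3)

/-- The determinant `O(2) → {1, -1}`. -/
def det2 (f : O2) : ℝ := LinearMap.det (f.toLinearEquiv : ℂ →ₗ[ℝ] ℂ)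

/-- The action of `O(2)` on the time circle. -/
def onCircle (f : O2) (t : Circle) : Circle :=
  ⟨f t, by simp [Submonoid.unitSphere, f.norm_map, Circle.norm_coe]⟩

/-- The angle `δ(f)`, as the element `e^{iδ} = f(1)` of the circle: `f` is the time
transformation `t ↦ t + δ` or `t ↦ -t + δ`. -/
def shift (f : O2) : Circle := onCircle f 1

/-- The reflection of the plane (of the time circle) along the real axis. -/
def refl : O2 := Complex.conjLIE

/-! ### Elementary facts about `O(2)` -/

theorem refl_apply (z : ℂ) : refl z = (starRingEnd ℂ) z := rfl

theorem coe_onCircle (f : O2) (t : Circle) : (onCircle f t : ℂ) = f t := rfl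

theorem det2_mul (f g : O2) : det2 (f * g) = det2 f * det2 g := by
  unfold det2
  rw [← LinearMap.det_comp]
  rfl

theorem det2_one : det2 1 = 1 := LinearMap.det_id

theorem det2_rotation (a : Circle) : det2 (rotation a) = 1 := det_rotation a

theorem det2_refl : det2 refl = -1 := Complex.det_conjLIE

theorem onCircle_rotation (a t : Circle) : onCircle (rotation a) t = a * t := by
  apply Circle.ext
  rw [coe_onCircle, rotation_apply, Circle.coe_mul]

theorem onCircle_rotation_mul_refl (a t : Circle) :
    onCircle (rotation a * refl) t = a * t⁻¹ := by
  apply Circle.ext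
  rw [coe_onCircle, Circle.coe_mul, Circle.coe_inv_eq_conj]
  rfl

theorem shift_one : shift 1 = 1 := by
  apply Circle.ext
  simp [shift, coe_onCircle]

theorem shift_rotation (a : Circle) : shift (rotation a) = a := by
  rw [shift, onCircle_rotation, mul_one]

theorem shift_rotation_mul_refl (a : Circle) : shift (rotation a * refl) = a := by
  rw [shift, onCircle_rotation_mul_refl, inv_one, mul_one]

theorem eq_rotation_or (f : O2) : ∃ a, f = rotation a ∨ f = rotation a * refl :=
  linear_isometry_complex f

theorem refl_mul_rotation (a : Circle) : refl * rotation a = rotation a⁻¹ * refl := by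
  ext z
  change (starRingEnd ℂ) (a * z) = ((a⁻¹ : Circle) : ℂ) * (starRingEnd ℂ) z
  rw [map_mul, Circle.coe_inv_eq_conj]

theorem refl_mul_refl : refl * refl = 1 := by
  ext z
  simp [refl_apply]

theorem rr (a b : Circle) : rotation a * (rotation b * refl) = rotation (a * b) * refl := by
  rw [map_mul, mul_assoc]

theorem rfr (a b : Circle) : rotation a * refl * rotation b = rotation (a * b⁻¹) * refl := by
  rw [mul_assoc, refl_mul_rotation, map_mul, mul_assoc]

theorem rfrf (a b : Circle) :
    rotation a * refl * (rotation b * refl) = rotation (a * b⁻¹) := by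
  rw [← mul_assoc, rfr, mul_assoc, refl_mul_refl, mul_one]

/-- For an integer `k`, the endomorphism of `O(2)` that sends the rotation of angle `δ` to the
rotation of angle `kδ` and the reflection `t ↦ -t + δ` to `t ↦ -t + kδ`. -/
def powHom (k : ℤ) : O2 →* O2 where
  toFun f := rotation (shift f ^ (k - 1)) * f
  map_one' := by simp [shift_one]
  map_mul' f g := by
    obtain ⟨a, rfl | rfl⟩ := eq_rotation_or f <;> obtain ⟨b, rfl | rfl⟩ := eq_rotation_or g
    · simp only [← map_mul, shift_rotation]
      rw [mul_zpow, mul_mul_mul_comm]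
    · simp only [← mul_assoc, ← map_mul, shift_rotation, shift_rotation_mul_refl]
      rw [mul_zpow, mul_right_comm (a ^ (k - 1))]
    · simp only [rfr, rr, ← map_mul, shift_rotation, shift_rotation_mul_refl]
      rw [mul_zpow, inv_zpow, mul_inv, mul_mul_mul_comm]
    · simp only [rfrf, rr, ← map_mul, shift_rotation, shift_rotation_mul_refl]
      rw [mul_zpow, inv_zpow, mul_inv, mul_mul_mul_comm]

/-- `powHom k f` is the transformation induced by `f` through the covering `t ↦ t ^ k` of the
time circle. -/
theorem powHom_onCircle (k : ℤ) (f : O2) (t : Circle) :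
    onCircle (powHom k f) (t ^ k) = onCircle f t ^ k := by
  change onCircle (rotation (shift f ^ (k - 1)) * f) (t ^ k) = _
  obtain ⟨a, rfl | rfl⟩ := eq_rotation_or f
  · rw [shift_rotation, ← map_mul, onCircle_rotation, onCircle_rotation, ← zpow_add_one,
      sub_add_cancel, mul_zpow]
  · rw [shift_rotation_mul_refl, rr, onCircle_rotation_mul_refl, onCircle_rotation_mul_refl,
      ← zpow_add_one, sub_add_cancel, mul_zpow, inv_zpow]

/-! ### Symmetry groups -/

/-- An action of the group `G` on the time circle (through `τ`), on the plane (through `ρ`) and on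
the set of indices of the bodies (through `σ`), such that bodies which are exchanged have
equal masses. -/
structure SymmetryAction (G : Type*) [Group G] (m : Fin 3 → ℝ) where
  τ : G →* O2
  ρ : G →* O2
  σ : G →* Perm3
  mass_eq : ∀ (g : G) (i : Fin 3), m (σ g i) = m i

/-! ### Loops and the action functional -/

/-- The velocity `ẋ_i` at the time of angle `s`. -/
def velocity (x : Circle → Fin 3 → ℂ) (i : Fin 3) (s : ℝ) : ℂ :=
  deriv (fun u : ℝ => x (Circle.exp u) i) s

/-- The Sobolev space `H¹` of loops (of period `2π`) of configurations of three bodies in the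
plane with masses `m` and centre of mass at the origin. A loop is in `H¹` when it is absolutely
continuous with square integrable derivative. -/
def loopSpace (m : Fin 3 → ℝ) : Set (Circle → Fin 3 → ℂ) :=
  {x | (∀ t, ∑ i, (m i : ℂ) * x t i = 0) ∧
    ∀ i, AbsolutelyContinuousOnInterval (fun s : ℝ => x (Circle.exp s) i) 0 (2 * Real.pi) ∧
      MemLp (velocity x i) 2 (volume.restrict (Set.Ioc 0 (2 * Real.pi)))}

/-- The `H¹` norm of a loop. -/
def h1Norm (x : Circle → Fin 3 → ℂ) : ℝ :=
  Real.sqrt (∑ i, ∫ s in (0 : ℝ)..(2 * Real.pi), (‖x (Circle.exp s) i‖ ^ 2 + ‖velocity x i s‖ ^ 2))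

/-- The term `m_i m_j / |x_i - x_j|^α` of the potential, infinite at a collision. -/
def pairPotential (m : Fin 3 → ℝ) (α : ℝ) (c : Fin 3 → ℂ) (i j : Fin 3) : ℝ≥0∞ :=
  ENNReal.ofReal (m i * m j) / ENNReal.ofReal (‖c i - c j‖ ^ α)

/-- The potential function `U`, with values in `[0, ∞]`. -/
def potential (m : Fin 3 → ℝ) (α : ℝ) (c : Fin 3 → ℂ) : ℝ≥0∞ :=
  pairPotential m α c 0 1 + pairPotential m α c 0 2 + pairPotential m α c 1 2

/-- The kinetic energy in the frame rotating with angular velocity `ω`. -/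
def kinetic (m : Fin 3 → ℝ) (ω : ℝ) (c v : Fin 3 → ℂ) : ℝ :=
  ∑ i, m i / 2 * ‖v i - Complex.I * ω * c i‖ ^ 2

/-- The Lagrangian action functional `A_ω`, with values in `[0, ∞]`. -/
def action (m : Fin 3 → ℝ) (α ω : ℝ) (x : Circle → Fin 3 → ℂ) : ℝ≥0∞ :=
  ∫⁻ s in Set.Ioc 0 (2 * Real.pi),
    (ENNReal.ofReal (kinetic m ω (x (Circle.exp s)) (fun i => velocity x i s)) +
      potential m α (x (Circle.exp s)))

/-- The loop `x` has a collision at some time. -/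
def HasCollision (x : Circle → Fin 3 → ℂ) : Prop :=
  ∃ (t : Circle) (i j : Fin 3), i ≠ j ∧ x t i = x t j

namespace SymmetryAction

variable {G : Type*} [Group G] {m : Fin 3 → ℝ}

/-- The action of `G` on loops: `(g x)(t) = g (x (g⁻¹ t))`, where `G` acts on configurations by
`(g c)_i = ρ(g) c_{g⁻¹ i}`. -/
def actLoop (S : SymmetryAction G m) (g : G) (x : Circle → Fin 3 → ℂ) : Circle → Fin 3 → ℂ :=
  fun t i => S.ρ g (x (onCircle (S.τ g⁻¹) t) (S.σ g⁻¹ i))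

/-- The space `Λ^G` of equivariant loops. -/
def equivariantLoops (S : SymmetryAction G m) : Set (Circle → Fin 3 → ℂ) :=
  {x | x ∈ loopSpace m ∧ ∀ g, S.actLoop g x = x}

/-- Every equivariant loop has a collision. -/
def BoundToCollisions (S : SymmetryAction G m) : Prop :=
  ∀ x ∈ S.equivariantLoops, HasCollision x

/-- Every equivariant loop is constant up to similarity: it is a fixed configuration multiplied by
a complex function of time. -/
def Homographic (S : SymmetryAction G m) : Prop :=
  ∀ x ∈ S.equivariantLoops, ∃ (ξ : Fin 3 → ℂ) (z : Circle → ℂ), ∀ t i, x t i = z t * ξ i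

/-- The determinants of `ρ` and `τ` coincide. -/
def IsTypeR (S : SymmetryAction G m) : Prop :=
  ∀ g, det2 (S.ρ g) = det2 (S.τ g)

/-- The action functional `A_0` (in the frame that does not rotate) diverges to infinity on the
equivariant loops as the `H¹` norm goes to infinity. -/
def Coercive (S : SymmetryAction G m) (α : ℝ) : Prop :=
  ∀ C : ℝ≥0, ∃ R : ℝ, ∀ x ∈ S.equivariantLoops, R ≤ h1Norm x → (C : ℝ≥0∞) ≤ action m α 0 x

/-- Neither of type R nor coercive. -/
def FullyUncoercive (S : SymmetryAction G m) (α : ℝ) : Prop :=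
  ¬ S.IsTypeR ∧ ¬ S.Coercive α

/-! ### Change of rotating frame -/

theorem rotation_aux {f g : O2} (h : det2 f = det2 g) (b : Circle) (k : ℤ) :
    rotation (shift f ^ k) * g * rotation (b ^ k) = rotation (onCircle f b ^ k) * g := by
  obtain ⟨a, rfl | rfl⟩ := eq_rotation_or f <;> obtain ⟨c, rfl | rfl⟩ := eq_rotation_or g
  · rw [onCircle_rotation, shift_rotation, ← map_mul, ← map_mul, ← map_mul, mul_zpow,
      mul_right_comm]
  · rw [det2_mul, det2_rotation, det2_rotation, det2_refl] at h
    norm_num at h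
  · rw [det2_mul, det2_rotation, det2_rotation, det2_refl] at h
    norm_num at h
  · rw [onCircle_rotation_mul_refl, shift_rotation_mul_refl, rr, rfr, rr, mul_zpow, inv_zpow,
      mul_right_comm]

/-- The same group seen in the frame rotating with integer angular velocity `ω`. When `G` is of
type R, `x(t) = e^{iωt} q(t)` is equivariant for `S` if and only if `q` is equivariant for the
action in which `ρ(g)` is replaced by `e^{-iωδ(g)} ρ(g)`, with `τ(g)` the time transformation
`t ↦ ± t + δ(g)`. -/
def rotatingFrame (S : SymmetryAction G m) (hS : S.IsTypeR) (ω : ℤ) : SymmetryAction G m where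
  τ := S.τ
  ρ :=
    { toFun := fun g => rotation (shift (S.τ g) ^ (-ω)) * S.ρ g
      map_one' := by simp [shift_one]
      map_mul' := fun g h => by
        have h1 : shift (S.τ (g * h)) = onCircle (S.τ g) (shift (S.τ h)) := by
          rw [map_mul]; rfl
        rw [h1, ← mul_assoc, rotation_aux (hS g).symm, map_mul, mul_assoc] }
  σ := S.σ
  mass_eq := S.mass_eq

/-- In the frame rotating with angular velocity `ω`, the loop `q` is seen in place of
`x(t) = e^{iωt} q(t)`. -/
theorem actLoop_rotatingFrame (S : SymmetryAction G m) (hS : S.IsTypeR) (ω : ℤ) (g : G)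
    (q : Circle → Fin 3 → ℂ) (t : Circle) (i : Fin 3) :
    S.actLoop g (fun t i => ((t ^ ω : Circle) : ℂ) * q t i) t i
      = ((t ^ ω : Circle) : ℂ) * (S.rotatingFrame hS ω).actLoop g q t i := by
  change S.ρ g (rotation (onCircle (S.τ g⁻¹) t ^ ω) _) =
    rotation (t ^ ω) (rotation (shift (S.τ g) ^ (-ω)) (S.ρ g _))
  set w := q (onCircle (S.τ g⁻¹) t) (S.σ g⁻¹ i)
  have h := rotation_aux (hS g).symm (onCircle (S.τ g⁻¹) t) ω
  have ht : onCircle (S.τ g) (onCircle (S.τ g⁻¹) t) = t := by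
    apply Circle.ext
    rw [coe_onCircle, coe_onCircle]
    change (S.τ g * S.τ g⁻¹) t = t
    rw [← map_mul, mul_inv_cancel, map_one]; rfl
  rw [ht] at h
  have h2 := congrArg (fun f => rotation (shift (S.τ g) ^ (-ω)) (f w)) h
  simp only [LinearIsometryEquiv.coe_mul, Function.comp_apply, rotation_apply] at h2 ⊢
  rw [← mul_assoc, ← mul_assoc, ← Circle.coe_mul, ← zpow_add, neg_add_cancel, zpow_zero,
    Circle.coe_one, one_mul] at h2
  exact h2.trans (by rw [mul_assoc, mul_left_comm]; rfl)

/-- `S'` is obtained from `S` by a change of rotating frame. A frame that actually rotates is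
available only if the action is of type R. -/
def RotatingFrameChange (S S' : SymmetryAction G m) : Prop :=
  S' = S ∨ ∃ (hS : S.IsTypeR) (ω : ℤ), S' = S.rotatingFrame hS ω

/-! ### Reduction of redundant symmetries -/

/-- The redundant symmetries together with those that act trivially: the elements of `G` that act
as a (possibly trivial) translation on the time circle, and as the identity on the plane and on
the indices. -/
def redundant (S : SymmetryAction G m) : Subgroup G where
  carrier := {g | det2 (S.τ g) = 1 ∧ S.ρ g = 1 ∧ S.σ g = 1}
  one_mem' := by simp [det2_one]
  mul_mem' := by
    rintro a b ⟨h1, h2, h3⟩ ⟨h4, h5, h6⟩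
    simp [det2_mul, h1, h2, h3, h4, h5, h6]
  inv_mem' := by
    rintro a ⟨h1, h2, h3⟩
    refine ⟨?_, by simp [h2], by simp [h3]⟩
    have h := det2_mul (S.τ a⁻¹) (S.τ a)
    rw [← map_mul, inv_mul_cancel, map_one, det2_one, h1, mul_one] at h
    exact h.symm

/-- The number of time translations induced by redundant symmetries. All equivariant loops have
period `2π / redundancy`. -/
def redundancy (S : SymmetryAction G m) : ℕ := Nat.card (S.redundant.map S.τ)

/-- The group with its redundant symmetries modded out and time rescaled to the period `2π`, as a
subgroup of `O(2) × O(2) × Σ₃`: the time circle divided by the translations of angle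
`2π / redundancy` is again the circle, by the map `t ↦ t ^ redundancy`. If `G` is
finite, the kernel of the homomorphism below is `S.redundant`, so that the subgroup is `G`
modulo `S.redundant` with its induced action. -/
def reducedGroup (S : SymmetryAction G m) : Subgroup (O2 × O2 × Perm3) :=
  (((powHom S.redundancy).comp S.τ).prod (S.ρ.prod S.σ)).range

end SymmetryAction

/-! ### The list of groups -/

/-- The ten groups in the list. -/
inductive TableName
  | trivial | line | choreography21 | isosceles | hill | choreography3 | lagrange | c6 | d6 | d12

/-- Rotation by the angle `θ`. -/
def rot (θ : ℝ) : O2 := rotation (Circle.exp θ)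

/-- The transposition `(1,2)` of the first two bodies. -/
def swap12 : Perm3 := Equiv.swap 0 1

/-- The cyclic permutation `(1,2,3)` of the bodies. -/
def cycle123 : Perm3 := finRotate 3

/-- Generator of the `2`-`1`-choreography symmetry: `(τ, ρ, σ) = (translation by π, 1, (1,2))`. -/
def choreo21Gen : O2 × O2 × Perm3 := (rot Real.pi, 1, swap12)

/-- Generator of the line symmetry. -/
def lineGen : O2 × O2 × Perm3 := (refl, refl, 1)

/-- Generator of the isosceles symmetry. -/
def isoscelesGen : O2 × O2 × Perm3 := (refl, refl, swap12)

/-- Generator of the `3`-choreography symmetry. -/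
def choreo3Gen : O2 × O2 × Perm3 := (rot (2 * Real.pi / 3), 1, cycle123)

/-- Generator of the group `C₆`. -/
def c6Gen : O2 × O2 × Perm3 := (rot (Real.pi / 3), refl, cycle123)

/-- The element of `D₆` and `D₁₂` that reverses time, with the antipodal map on the plane. -/
def antipodalGen : O2 × O2 × Perm3 := (refl, LinearIsometryEquiv.neg ℝ, swap12)

/-- The ten symmetry groups, of orders `1, 2, 2, 2, 4, 3, 6, 6, 6, 12`. -/
def tableGroup : TableName → Subgroup (O2 × O2 × Perm3)
  | .trivial => ⊥
  | .line => Subgroup.closure {lineGen}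
  | .choreography21 => Subgroup.closure {choreo21Gen}
  | .isosceles => Subgroup.closure {isoscelesGen}
  | .hill => Subgroup.closure {choreo21Gen, lineGen}
  | .choreography3 => Subgroup.closure {choreo3Gen}
  | .lagrange => Subgroup.closure {choreo3Gen, isoscelesGen}
  | .c6 => Subgroup.closure {c6Gen}
  | .d6 => Subgroup.closure {c6Gen ^ 2, antipodalGen}
  | .d12 => Subgroup.closure {c6Gen, antipodalGen}

/-- Conjugation of subgroups of `O(2) × O(2) × Σ₃`. -/
def Conjugated (H K : Subgroup (O2 × O2 × Perm3)) : Prop :=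
  ∃ c : O2 × O2 × Perm3, H.map (MulAut.conj c).toMonoidHom = K

end ThreeBody

end

/-!
Assume that some equivariant loop `x` has no collision, that the action is not homographic, and
that it is coercive or of type R. The list is obtained by determining the possible images of `G`
in `O(2) × O(2) × Σ₃`.

The only analytic ingredient is `Coercive.eq_zero`: a coercive action with a collision-free
equivariant loop `x` fixes no configuration `y ≠ 0`, because the loops `x + l y`, for large `l`,
have the velocity of `x` and mutual distances bounded away from zero, hence bounded action.

The core `ker τ` acts trivially (`trivialCore`). A core element that rotates the plane leaves only
symmetric pairs with the third body at the origin or equilateral triangles, which are homographic.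
A core element that reflects the plane rules out type R; it confines some `x_i - x_j` to a line,
where it cannot change sign, so that summing `x` over an orbit of instants gives an invariant
configuration `y ≠ 0`, which contradicts coercivity (`not_coercive_of_core_reflection`).

The reduced group is then isomorphic to its image in the time `O(2)`: it is generated by an element
`g₀` that translates time by `2π / N` and acts on the plane and the bodies with order exactly `N`
(`TrivialCore.exists_generator`), and, if time reversals are present, by any one of them, `h`, for
which `h² = (h g₀)² = 1`.

* For type R, a rotating frame makes `g₀` act trivially on the plane (`exists_rotatingFrame`). Then
  `N` is the order of a permutation of three bodies, and the action on the bodies determines the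
  group up to conjugation (`exists_conjugated_of_isTypeR`): the first seven groups.
* Otherwise the action is coercive. At an instant fixed by a time reversal that acts on the plane
  by `+1` or `-1`, absence of collisions forces the permutation to be trivial, respectively
  nontrivial (`reversal_alternative`). Unless `g₀` permutes the bodies cyclically, either this
  alternative is violated or there is an explicit invariant collinear configuration, against
  `Coercive.eq_zero`. What remains is `C₆` and `D₁₂` if `g₀` reflects the plane
  (`exists_conjugated_of_translation_reflection`), and `D₆` if it does not
  (`exists_conjugated_of_translation_rotation`).
-/

noncomputable section

namespace ThreeBody

/-! ### Rotations and reflections of the plane -/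

theorem exists_eq_rotation {f : O2} (h : det2 f = 1) : ∃ a, f = rotation a := by
  obtain ⟨a, rfl | rfl⟩ := eq_rotation_or f
  · exact ⟨a, rfl⟩
  · rw [det2_mul, det2_rotation, det2_refl] at h
    norm_num at h

theorem exists_eq_rotation_mul_refl {f : O2} (h : det2 f ≠ 1) : ∃ a, f = rotation a * refl := by
  obtain ⟨a, rfl | rfl⟩ := eq_rotation_or f
  · exact absurd (det2_rotation a) h
  · exact ⟨a, rfl⟩

theorem det2_eq_neg_one {f : O2} (h : det2 f ≠ 1) : det2 f = -1 := by
  obtain ⟨a, rfl⟩ := exists_eq_rotation_mul_refl h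
  rw [det2_mul, det2_rotation, det2_refl, one_mul]

theorem det2_mul_ne_one {f g : O2} (hf : det2 f ≠ 1) (hg : det2 g = 1) : det2 (f * g) ≠ 1 := by
  rwa [det2_mul, hg, mul_one]

theorem det2_mul_eq_one {f g : O2} (hf : det2 f ≠ 1) (hg : det2 g ≠ 1) : det2 (f * g) = 1 := by
  rw [det2_mul, det2_eq_neg_one hf, det2_eq_neg_one hg, neg_one_mul, neg_neg]

theorem det2_pow_eq_one {f : O2} (h : det2 f = 1) (k : ℕ) : det2 (f ^ k) = 1 := by
  obtain ⟨a, rfl⟩ := exists_eq_rotation h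
  rw [← map_pow, det2_rotation]

theorem mul_self_eq_one_of_det2_ne_one {f : O2} (h : det2 f ≠ 1) : f * f = 1 := by
  obtain ⟨a, rfl⟩ := exists_eq_rotation_mul_refl h
  rw [rfrf, mul_inv_cancel, map_one]

theorem circle_exists_mul_self_eq (a : Circle) : ∃ b : Circle, b * b = a := by
  obtain ⟨s, rfl⟩ := Circle.exp_surjective a
  exact ⟨Circle.exp (s / 2), by rw [← Circle.exp_add, add_halves]⟩

theorem circle_eq_one_or_neg_one {a : Circle} (h : a * a = 1) : a = 1 ∨ a = -1 := by
  have h' : (a : ℂ) * a = 1 := by rw [← Circle.coe_mul, h, Circle.coe_one]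
  rcases mul_self_eq_one_iff.mp h' with h | h
  · exact Or.inl (Circle.ext h)
  · exact Or.inr (Circle.ext h)

theorem rotation_neg_one_apply (z : ℂ) : rotation (-1) z = -z := by
  rw [rotation_apply, Circle.coe_neg, Circle.coe_one, neg_one_mul]

theorem neg_eq_rotation : (LinearIsometryEquiv.neg ℝ : O2) = rotation (-1) := by
  ext z
  rw [rotation_neg_one_apply]
  rfl

theorem rotation_eq_one_or_of_mul_self {f : O2} (hf : det2 f = 1) (h : f * f = 1) :
    f = 1 ∨ f = rotation (-1) := by
  obtain ⟨a, rfl⟩ := exists_eq_rotation hf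
  rw [← map_mul, ← map_one rotation] at h
  rcases circle_eq_one_or_neg_one (rotation_injective h) with rfl | rfl
  · exact Or.inl (map_one _)
  · exact Or.inr rfl

theorem exists_conj_eq_refl {f : O2} (hf : det2 f ≠ 1) :
    ∃ b, rotation b * f * (rotation b)⁻¹ = refl := by
  obtain ⟨a, rfl⟩ := exists_eq_rotation_mul_refl hf
  obtain ⟨b, rfl⟩ := circle_exists_mul_self_eq a
  refine ⟨b⁻¹, ?_⟩
  rw [rr, ← map_inv, rfr, inv_inv, inv_mul_cancel_left, mul_inv_cancel, map_one, one_mul]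

theorem rotation_conj (a b : Circle) :
    rotation b * rotation a * (rotation b)⁻¹ = rotation a := by
  rw [← map_inv, ← map_mul, ← map_mul, mul_right_comm, mul_inv_cancel, one_mul]

/-- The axis of a reflection is spanned by a vector `u`, and its normal by `i u`. -/
theorem exists_axis {f : O2} (hf : det2 f ≠ 1) :
    ∃ u : ℂ, u ≠ 0 ∧ f u = u ∧ f (Complex.I * u) = -(Complex.I * u) := by
  obtain ⟨a, rfl⟩ := exists_eq_rotation_mul_refl hf
  obtain ⟨b, rfl⟩ := circle_exists_mul_self_eq a
  have h : ((b * b : Circle) : ℂ) * (starRingEnd ℂ) b = b := by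
    rw [← Circle.coe_inv_eq_conj, ← Circle.coe_mul, mul_inv_cancel_right]
  refine ⟨b, b.coe_ne_zero, h, ?_⟩
  change ((b * b : Circle) : ℂ) * (starRingEnd ℂ) (Complex.I * b) = _
  rw [map_mul, Complex.conj_I, mul_left_comm, h, neg_mul]

/-- A time reversal fixes an instant. -/
theorem exists_onCircle_eq {f : O2} (hf : det2 f ≠ 1) : ∃ t, onCircle f t = t := by
  obtain ⟨a, rfl⟩ := exists_eq_rotation_mul_refl hf
  obtain ⟨b, rfl⟩ := circle_exists_mul_self_eq a
  exact ⟨b, by rw [onCircle_rotation_mul_refl, mul_inv_cancel_right]⟩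

theorem det2_powHom (k : ℤ) (f : O2) : det2 (powHom k f) = det2 f := by
  change det2 (rotation _ * f) = _
  rw [det2_mul, det2_rotation, one_mul]

theorem powHom_rotation (k : ℤ) (a : Circle) : powHom k (rotation a) = rotation (a ^ k) := by
  change rotation (shift (rotation a) ^ (k - 1)) * rotation a = _
  rw [shift_rotation, ← map_mul, ← zpow_add_one, sub_add_cancel]

/-! ### Finite groups of rotations -/

theorem isPrimitiveRoot_circleExp {N : ℕ} (hN : N ≠ 0) :
    IsPrimitiveRoot (Circle.exp (2 * Real.pi / N)) N := by
  refine IsPrimitiveRoot.of_map_of_injective (f := Circle.coeHom) ?_ Circle.coe_injective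
  convert Complex.isPrimitiveRoot_exp N hN using 1
  change ((Circle.exp _ : Circle) : ℂ) = _
  rw [Circle.coe_exp]
  congr 1
  push_cast
  ring

theorem exists_eq_circleExp_pow {N : ℕ} (hN : N ≠ 0) {a : Circle} (ha : a ^ N = 1) :
    ∃ k : ℕ, a = Circle.exp (2 * Real.pi / N) ^ k := by
  have : NeZero N := ⟨hN⟩
  have h := (isPrimitiveRoot_circleExp hN).map_of_injective (f := Circle.coeHom)
    Circle.coe_injective
  obtain ⟨k, -, hk⟩ := h.eq_pow_of_pow_eq_one (ξ := (a : ℂ))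
    (by rw [← Circle.coe_pow, ha, Circle.coe_one])
  refine ⟨k, Circle.ext ?_⟩
  rw [← hk, Circle.coe_pow]
  rfl

theorem rot_pow_eq_one_iff {N : ℕ} (hN : N ≠ 0) (k : ℕ) :
    rot (2 * Real.pi / N) ^ k = 1 ↔ N ∣ k := by
  rw [rot, ← map_pow, ← map_one rotation, rotation_injective.eq_iff]
  exact (isPrimitiveRoot_circleExp hN).pow_eq_one_iff_dvd k

/-- The rotations in a finite group of isometries are the powers of the one of angle `2π / N`. -/
theorem exists_rot_generator {G : Type*} [Group G] [Finite G] (f : G →* O2) :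
    ∃ N : ℕ, N ≠ 0 ∧ ∃ g₀, f g₀ = rot (2 * Real.pi / N) ∧
      ∀ g, det2 (f g) = 1 → ∃ k : ℕ, f g = f g₀ ^ k := by
  set P : Subgroup Circle := f.range.comap rotation with hP
  have : Finite f.range := Finite.of_surjective _ f.rangeRestrict_surjective
  have : Finite P := Finite.of_injective (fun a : P => (⟨rotation a, a.2⟩ : f.range))
    fun a b h => Subtype.ext (rotation_injective (congrArg Subtype.val h))
  have : IsCyclic P := isCyclic_of_injective_ringHom (Circle.coeHom.comp P.subtype)
    (Circle.coe_injective.comp Subtype.val_injective)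
  have hN : Nat.card P ≠ 0 := Nat.card_pos.ne'
  have : NeZero (Nat.card P) := ⟨hN⟩
  have hpow (a : Circle) (ha : a ∈ P) : a ^ Nat.card P = 1 :=
    congrArg Subtype.val (pow_card_eq_one' (x := (⟨a, ha⟩ : P)))
  have hmem : Circle.exp (2 * Real.pi / Nat.card P) ∈ P := by
    obtain ⟨a, ha⟩ := IsCyclic.exists_generator (α := P)
    have hprim : IsPrimitiveRoot a (Nat.card P) := by
      rw [← orderOf_eq_card_of_forall_mem_zpowers ha]
      exact IsPrimitiveRoot.orderOf a
    have hinj : Function.Injective (Circle.coeHom.comp P.subtype) :=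
      Circle.coe_injective.comp Subtype.val_injective
    obtain ⟨k, -, hk⟩ := (hprim.map_of_injective hinj).eq_pow_of_pow_eq_one
      (ξ := (Circle.exp (2 * Real.pi / Nat.card P) : ℂ))
      (by rw [← Circle.coe_pow, (isPrimitiveRoot_circleExp hN).pow_eq_one, Circle.coe_one])
    have : (a : Circle) ^ k = Circle.exp (2 * Real.pi / Nat.card P) := Circle.ext hk
    exact this ▸ P.pow_mem a.2 k
  obtain ⟨g₀, hg₀⟩ := hmem
  refine ⟨Nat.card P, hN, g₀, hg₀, fun g hg => ?_⟩
  obtain ⟨a, ha⟩ := exists_eq_rotation hg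
  obtain ⟨k, rfl⟩ := exists_eq_circleExp_pow hN (hpow a ⟨g, ha⟩)
  exact ⟨k, by rw [ha, hg₀]; exact map_pow rotation _ k⟩

/-! ### Reduced groups and their generators -/

namespace SymmetryAction

variable {G : Type*} [Group G] {m : Fin 3 → ℝ}

/-- The homomorphism onto the reduced group. -/
def reducedHom (S : SymmetryAction G m) : G →* O2 × O2 × Perm3 :=
  ((powHom S.redundancy).comp S.τ).prod (S.ρ.prod S.σ)

/-- The core `ker τ`, which acts on the configuration at each instant, acts trivially. -/
def TrivialCore (S : SymmetryAction G m) : Prop :=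
  ∀ g, S.τ g = 1 → S.ρ g = 1 ∧ S.σ g = 1

theorem range_reducedHom (S : SymmetryAction G m) : S.reducedHom.range = S.reducedGroup := rfl

variable {S : SymmetryAction G m}

/-- The time translations induced by redundant symmetries are the powers of the one of angle
`2π / redundancy`. -/
theorem exists_redundant_generator [Finite G] (S : SymmetryAction G m) :
    ∃ g₀ ∈ S.redundant, S.redundancy ≠ 0 ∧ S.τ g₀ = rot (2 * Real.pi / S.redundancy) ∧
      ∀ g ∈ S.redundant, ∃ k : ℕ, S.τ g = S.τ g₀ ^ k := by
  obtain ⟨N, hN, ⟨g₀, hg₀⟩, h₁, h₂⟩ := exists_rot_generator (S.τ.comp S.redundant.subtype)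
  have h₃ (g) (hg : g ∈ S.redundant) : ∃ k : ℕ, S.τ g = S.τ g₀ ^ k := h₂ ⟨g, hg⟩ hg.1
  have h₄ : S.τ g₀ = rot (2 * Real.pi / N) := h₁
  have h₅ : S.redundant.map S.τ = Subgroup.zpowers (S.τ g₀) := by
    refine le_antisymm ?_ ?_
    · rintro _ ⟨g, hg, rfl⟩
      obtain ⟨k, hk⟩ := h₃ g hg
      rw [hk]
      exact Subgroup.pow_mem _ (Subgroup.mem_zpowers _) k
    · rw [Subgroup.zpowers_le]
      exact ⟨g₀, hg₀, rfl⟩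
  have h₆ : S.redundancy = N := by
    rw [redundancy, h₅, Nat.card_zpowers, h₄]
    exact Nat.dvd_antisymm (orderOf_dvd_of_pow_eq_one ((rot_pow_eq_one_iff hN N).mpr dvd_rfl))
      ((rot_pow_eq_one_iff hN _).mp (pow_orderOf_eq_one _))
  rw [h₆]
  exact ⟨g₀, hg₀, hN, h₄, h₃⟩

/-- If the core is trivial, the reduced group acts faithfully on the reduced time circle, and its
time translations act faithfully on the plane and the bodies. -/
theorem TrivialCore.powHom_eq_one_iff [Finite G] (hS : S.TrivialCore) (g : G) :
    powHom S.redundancy (S.τ g) = 1 ↔ det2 (S.τ g) = 1 ∧ S.ρ g = 1 ∧ S.σ g = 1 := by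
  obtain ⟨g₀, hg₀, hn, h₁, h₂⟩ := S.exists_redundant_generator
  constructor
  · intro h
    have hdet : det2 (S.τ g) = 1 := by rw [← det2_powHom S.redundancy, h, det2_one]
    obtain ⟨a, ha⟩ := exists_eq_rotation hdet
    rw [ha, powHom_rotation, ← map_one rotation, rotation_injective.eq_iff, zpow_natCast] at h
    obtain ⟨k, rfl⟩ := exists_eq_circleExp_pow hn h
    have h₃ : S.τ (g * (g₀ ^ k)⁻¹) = 1 := by
      rw [map_mul, map_inv, map_pow, h₁, ha, map_pow, rot, mul_inv_cancel]
    obtain ⟨h₄, h₅⟩ := hS _ h₃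
    refine ⟨hdet, ?_, ?_⟩
    · simpa [hg₀.2.1] using h₄
    · simpa [hg₀.2.2] using h₅
  · intro h
    obtain ⟨k, hk⟩ := h₂ g h
    rw [hk, h₁, map_pow, rot, powHom_rotation, zpow_natCast,
      (isPrimitiveRoot_circleExp hn).pow_eq_one, map_one, one_pow]

theorem TrivialCore.reducedHom_eq_one [Finite G] (hS : S.TrivialCore) {g : G}
    (h : powHom S.redundancy (S.τ g) = 1) : S.reducedHom g = 1 := by
  obtain ⟨-, h₁, h₂⟩ := (hS.powHom_eq_one_iff g).mp h
  exact Prod.ext h (Prod.ext h₁ h₂)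

/-- The time translations in the reduced group are the powers of an element `g₀` that acts on the
time circle by a translation of angle `2π / N`, and on the plane and the bodies with order `N`. -/
theorem TrivialCore.exists_generator [Finite G] (hS : S.TrivialCore) :
    ∃ N : ℕ, N ≠ 0 ∧ ∃ g₀, powHom S.redundancy (S.τ g₀) = rot (2 * Real.pi / N) ∧
      det2 (S.τ g₀) = 1 ∧ (∀ k : ℕ, N ∣ k ↔ S.ρ g₀ ^ k = 1 ∧ S.σ g₀ ^ k = 1) ∧
      ∀ g, det2 (S.τ g) = 1 → ∃ k : ℕ, S.reducedHom g = S.reducedHom g₀ ^ k := by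
  obtain ⟨N, hN, g₀, h₁, h₂⟩ := exists_rot_generator ((powHom S.redundancy).comp S.τ)
  have h₁' : powHom S.redundancy (S.τ g₀) = rot (2 * Real.pi / N) := h₁
  have hdet : det2 (S.τ g₀) = 1 := by
    rw [← det2_powHom S.redundancy, h₁', rot, det2_rotation]
  refine ⟨N, hN, g₀, h₁, hdet, fun k => ?_, fun g hg => ?_⟩
  · rw [← rot_pow_eq_one_iff hN, ← h₁', ← map_pow, ← map_pow, hS.powHom_eq_one_iff, map_pow,
      map_pow, map_pow]
    exact and_iff_right (det2_pow_eq_one hdet k)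
  · obtain ⟨k, hk⟩ := h₂ g (by rw [← hg]; exact det2_powHom _ _)
    refine ⟨k, ?_⟩
    have h : S.reducedHom (g * (g₀ ^ k)⁻¹) = 1 := hS.reducedHom_eq_one <| by
      have : powHom S.redundancy (S.τ g) = powHom S.redundancy (S.τ g₀) ^ k := hk
      rw [map_mul, map_mul, map_inv, map_inv, map_pow, map_pow, this, mul_inv_cancel]
    rwa [map_mul, map_inv, mul_inv_eq_one, map_pow] at h

theorem TrivialCore.mul_self_eq_one (hS : S.TrivialCore) {h : G} (hh : det2 (S.τ h) ≠ 1) :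
    S.ρ h * S.ρ h = 1 ∧ S.σ h * S.σ h = 1 := by
  rw [← map_mul, ← map_mul]
  exact hS _ (by rw [map_mul, mul_self_eq_one_of_det2_ne_one hh])

theorem reducedGroup_eq_closure_singleton {g₀ : G} (hrot : ∀ g, det2 (S.τ g) = 1)
    (hg₀ : ∀ g, det2 (S.τ g) = 1 → ∃ k : ℕ, S.reducedHom g = S.reducedHom g₀ ^ k) :
    S.reducedGroup = Subgroup.closure {S.reducedHom g₀} := by
  rw [← range_reducedHom]
  refine le_antisymm ?_ ?_
  · rintro _ ⟨g, rfl⟩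
    obtain ⟨k, hk⟩ := hg₀ g (hrot g)
    rw [hk]
    exact Subgroup.pow_mem _ (Subgroup.subset_closure (Set.mem_singleton _)) k
  · rw [Subgroup.closure_le, Set.singleton_subset_iff]
    exact ⟨g₀, rfl⟩

theorem reducedGroup_eq_closure_pair {g₀ h : G} (hh : det2 (S.τ h) ≠ 1)
    (hg₀ : ∀ g, det2 (S.τ g) = 1 → ∃ k : ℕ, S.reducedHom g = S.reducedHom g₀ ^ k) :
    S.reducedGroup = Subgroup.closure {S.reducedHom g₀, S.reducedHom h} := by
  rw [← range_reducedHom]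
  refine le_antisymm ?_ ?_
  · set C : Subgroup (O2 × O2 × Perm3) :=
      Subgroup.closure {S.reducedHom g₀, S.reducedHom h}
    have h₁ : S.reducedHom h ∈ C :=
      Subgroup.subset_closure (Set.mem_insert_of_mem _ (Set.mem_singleton _))
    have h₂ (g) (hg : det2 (S.τ g) = 1) :
        S.reducedHom g ∈ C := by
      obtain ⟨k, hk⟩ := hg₀ g hg
      rw [hk]
      exact Subgroup.pow_mem _ (Subgroup.subset_closure (Set.mem_insert _ _)) k
    rintro _ ⟨g, rfl⟩
    by_cases hg : det2 (S.τ g) = 1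
    · exact h₂ g hg
    · have h₃ := h₂ (h * g) (by rw [map_mul]; exact det2_mul_eq_one hh hg)
      rw [map_mul] at h₃
      exact (Subgroup.mul_mem_cancel_left _ h₁).mp h₃
  · rw [Subgroup.closure_le, Set.insert_subset_iff, Set.singleton_subset_iff]
    exact ⟨⟨g₀, rfl⟩, ⟨h, rfl⟩⟩

end SymmetryAction

/-! ### Permutations of three bodies -/

theorem Perm3.eq_one_or (s : Perm3) :
    s = 1 ∨ (s ≠ 1 ∧ s * s = 1) ∨ (s ≠ 1 ∧ s * s ≠ 1 ∧ s ^ 3 = 1) := by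
  decide +revert

theorem Perm3.exists_eq_swap {s : Perm3} (h₁ : s ≠ 1) (h₂ : s * s = 1) :
    ∃ i j, i ≠ j ∧ s = Equiv.swap i j := by
  decide +revert

theorem Perm3.exists_conj_eq_swap12 {s : Perm3} (h₁ : s ≠ 1) (h₂ : s * s = 1) :
    ∃ p, p * s * p⁻¹ = swap12 := by
  unfold swap12
  decide +revert

theorem Perm3.exists_conj_eq_cycle123 {s : Perm3} (h₁ : s * s ≠ 1) (h₃ : s ^ 3 = 1) :
    ∃ p, p * s * p⁻¹ = cycle123 := by
  unfold cycle123
  decide +revert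

set_option synthInstance.maxHeartbeats 200000 in
set_option synthInstance.maxSize 100000 in
theorem Perm3.exists_conj_eq_cycle123_and_swap12 {s h : Perm3}
    (hs : s * s ≠ 1 ∧ s ^ 3 = 1) (hh : h * h = 1 ∧ (h * s) * (h * s) = 1) :
    ∃ p, p * s * p⁻¹ = cycle123 ∧ p * h * p⁻¹ = swap12 := by
  unfold cycle123 swap12
  decide +revert

set_option synthInstance.maxHeartbeats 200000 in
set_option synthInstance.maxSize 100000 in
theorem Perm3.mul_eq_one_of_involutions {s h : Perm3} (hs : s ≠ 1) (hs₂ : s * s = 1) (hh : h ≠ 1)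
    (hh₂ : h * h = 1) (hsh : (h * s) * (h * s) = 1) : h * s = 1 := by
  decide +revert

set_option synthInstance.maxHeartbeats 200000 in
set_option synthInstance.maxSize 100000 in
theorem Perm3.exists_conj_eq_cycle123_sq_and_swap12 {s h : Perm3}
    (hs : s * s ≠ 1 ∧ s ^ 3 = 1) (hh : h * h = 1 ∧ (h * s) * (h * s) = 1) :
    ∃ p, p * s * p⁻¹ = cycle123 ^ 2 ∧ p * h * p⁻¹ = swap12 := by
  unfold cycle123 swap12
  decide +revert

/-! ### Continuity and boundedness of the action along a fixed direction -/

theorem exists_exp_eq (t : Circle) : ∃ s ∈ Set.Icc 0 (2 * Real.pi), Circle.exp s = t := by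
  obtain ⟨s, rfl⟩ := Circle.exp_surjective t
  obtain ⟨u, hu, h⟩ := Circle.periodic_exp.exists_mem_Ico₀ Real.two_pi_pos s
  exact ⟨u, ⟨hu.1, hu.2.le⟩, h.symm⟩

theorem continuous_of_mem_loopSpace {m : Fin 3 → ℝ} {x : Circle → Fin 3 → ℂ}
    (hx : x ∈ loopSpace m) (i : Fin 3) : Continuous fun t => x t i := by
  let f : Set.Icc (0 : ℝ) (2 * Real.pi) → Circle := fun s => Circle.exp s
  have hf : Continuous f := by fun_prop
  have hq : Topology.IsQuotientMap f := hf.isClosedMap.isQuotientMap hf fun t => by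
    obtain ⟨s, hs, h⟩ := exists_exp_eq t
    exact ⟨⟨s, hs⟩, h⟩
  rw [hq.continuous_iff]
  have h := (hx.2 i).1.continuousOn
  rw [Set.uIcc_of_le Real.two_pi_pos.le] at h
  exact continuousOn_iff_continuous_domRestrict.mp h

theorem exists_forall_norm_le {m : Fin 3 → ℝ} {x : Circle → Fin 3 → ℂ}
    (hx : x ∈ loopSpace m) : ∃ B, ∀ t i, ‖x t i‖ ≤ B := by
  have hc : Continuous x := continuous_pi (continuous_of_mem_loopSpace hx)
  obtain ⟨B, hB⟩ := (isCompact_range hc).isBounded.exists_norm_le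
  exact ⟨B, fun t i => (norm_le_pi_norm _ i).trans (hB _ ⟨t, rfl⟩)⟩

theorem velocity_add_const (x : Circle → Fin 3 → ℂ) (y : Fin 3 → ℂ) :
    velocity (fun t i => x t i + y i) = velocity x := by
  funext i s
  simp [velocity]

theorem add_mem_loopSpace {m : Fin 3 → ℝ} {x : Circle → Fin 3 → ℂ} (hx : x ∈ loopSpace m)
    {y : Fin 3 → ℂ} (hy : ∑ i, (m i : ℂ) * y i = 0) :
    (fun t i => x t i + y i) ∈ loopSpace m := by
  refine ⟨fun t => ?_, fun i => ⟨?_, ?_⟩⟩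
  · simp only [mul_add, Finset.sum_add_distrib, hx.1 t, hy, add_zero]
  · exact (hx.2 i).1.add ((LipschitzWith.const (y i)).lipschitzOnWith.absolutelyContinuousOnInterval)
  · rw [velocity_add_const]
    exact (hx.2 i).2

/-- Far along a direction `y`, the distance of two bodies of `x + l y` stays away from zero. -/
theorem exists_forall_le_norm_sub {m : Fin 3 → ℝ} {x : Circle → Fin 3 → ℂ}
    (hx : x ∈ loopSpace m) (hcol : ¬ HasCollision x) (y : Fin 3 → ℂ) {i j : Fin 3} (hij : i ≠ j) :
    ∃ δ > 0, ∃ l₀ : ℝ, ∀ l : ℝ, l₀ ≤ l → ∀ t, δ ≤ ‖(x t i + l * y i) - (x t j + l * y j)‖ := by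
  by_cases hy : y i = y j
  · have hc : Continuous fun t => ‖x t i - x t j‖ :=
      ((continuous_of_mem_loopSpace hx i).sub (continuous_of_mem_loopSpace hx j)).norm
    obtain ⟨t₀, -, ht₀⟩ := isCompact_univ.exists_isMinOn Set.univ_nonempty hc.continuousOn
    refine ⟨‖x t₀ i - x t₀ j‖, norm_pos_iff.mpr fun h =>
      hcol ⟨t₀, i, j, hij, sub_eq_zero.mp h⟩, 0, fun l _ t => ?_⟩
    rw [hy, add_sub_add_right_eq_sub]
    exact ht₀ (Set.mem_univ t)
  · obtain ⟨B, hB⟩ := exists_forall_norm_le hx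
    have hpos : 0 < ‖y i - y j‖ := norm_pos_iff.mpr (sub_ne_zero.mpr hy)
    refine ⟨1, one_pos, max 0 ((1 + 2 * B) / ‖y i - y j‖), fun l hl t => ?_⟩
    have h0 : 0 ≤ l := (le_max_left _ _).trans hl
    have h1 : 1 + 2 * B ≤ l * ‖y i - y j‖ := (div_le_iff₀ hpos).mp ((le_max_right _ _).trans hl)
    have h2 : ‖(l : ℂ) * (y i - y j)‖ = l * ‖y i - y j‖ := by
      rw [norm_mul, Complex.norm_real, Real.norm_of_nonneg h0]
    have h3 := norm_sub_norm_le (l * (y i - y j)) (x t j - x t i)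
    have h4 := norm_sub_le (x t j) (x t i)
    have h5 : (x t i + l * y i) - (x t j + l * y j) = l * (y i - y j) - (x t j - x t i) := by ring
    rw [h5]
    linarith [hB t i, hB t j]

theorem exists_pairPotential_le {m : Fin 3 → ℝ} {α : ℝ} (hα : 0 < α) {x : Circle → Fin 3 → ℂ}
    (hx : x ∈ loopSpace m) (hcol : ¬ HasCollision x) (y : Fin 3 → ℂ) {i j : Fin 3} (hij : i ≠ j) :
    ∃ C : ℝ≥0∞, C ≠ ∞ ∧ ∃ l₀ : ℝ, ∀ l : ℝ, l₀ ≤ l → ∀ t,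
      pairPotential m α (fun i => x t i + l * y i) i j ≤ C := by
  obtain ⟨δ, hδ, l₀, h⟩ := exists_forall_le_norm_sub hx hcol y hij
  refine ⟨ENNReal.ofReal (m i * m j) / ENNReal.ofReal (δ ^ α),
    ENNReal.div_ne_top ENNReal.ofReal_ne_top ?_, l₀, fun l hl t => ?_⟩
  · exact (ENNReal.ofReal_pos.mpr (Real.rpow_pos_of_pos hδ α)).ne'
  · exact ENNReal.div_le_div_left
      (ENNReal.ofReal_le_ofReal (Real.rpow_le_rpow hδ.le (h l hl t) hα.le)) _

theorem integrable_kinetic {m : Fin 3 → ℝ} {x : Circle → Fin 3 → ℂ} (hx : x ∈ loopSpace m)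
    (c : ℝ → Fin 3 → ℂ) :
    Integrable (fun s => kinetic m 0 (c s) (fun i => velocity x i s))
      (volume.restrict (Set.Ioc 0 (2 * Real.pi))) := by
  simp only [kinetic, Complex.ofReal_zero, mul_zero, zero_mul, sub_zero]
  exact integrable_finsetSum _ fun i _ => ((hx.2 i).2.integrable_norm_pow two_ne_zero).const_mul _

/-- The action of `x + l y` stays bounded as `l → ∞`. -/
theorem exists_action_le {m : Fin 3 → ℝ} {α : ℝ} (hα : 0 < α) {x : Circle → Fin 3 → ℂ}
    (hx : x ∈ loopSpace m) (hcol : ¬ HasCollision x) (y : Fin 3 → ℂ) :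
    ∃ C : ℝ≥0, ∃ l₀ : ℝ, ∀ l : ℝ, l₀ ≤ l → action m α 0 (fun t i => x t i + l * y i) ≤ C := by
  obtain ⟨C₁, h₁, l₁, H₁⟩ := exists_pairPotential_le (m := m) hα hx hcol y (i := 0) (j := 1) (by decide)
  obtain ⟨C₂, h₂, l₂, H₂⟩ := exists_pairPotential_le (m := m) hα hx hcol y (i := 0) (j := 2) (by decide)
  obtain ⟨C₃, h₃, l₃, H₃⟩ := exists_pairPotential_le (m := m) hα hx hcol y (i := 1) (j := 2) (by decide)
  set K : ℝ≥0∞ := ∫⁻ s in Set.Ioc 0 (2 * Real.pi),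
    ENNReal.ofReal (kinetic m 0 0 (fun i => velocity x i s)) with hK
  have hKtop : K ≠ ∞ := (integrable_kinetic hx fun _ => 0).lintegral_lt_top.ne
  have hvol : volume (Set.Ioc 0 (2 * Real.pi)) ≠ ∞ := measure_Ioc_lt_top.ne
  set D := K + (C₁ + C₂ + C₃) * volume (Set.Ioc 0 (2 * Real.pi)) with hD
  have hDtop : D ≠ ∞ := by
    simp only [hD, ne_eq, ENNReal.add_eq_top, hKtop, false_or]
    exact ENNReal.mul_ne_top (by simp [h₁, h₂, h₃]) hvol
  refine ⟨D.toNNReal, max l₁ (max l₂ l₃), fun l hl => ?_⟩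
  rw [ENNReal.coe_toNNReal hDtop, hD, ← setLIntegral_const,
    ← lintegral_add_right _ measurable_const]
  refine lintegral_mono fun s => ?_
  have hv : velocity (fun t i => x t i + l * y i) = velocity x :=
    velocity_add_const x fun i => l * y i
  have h : kinetic m 0 (fun i => x (Circle.exp s) i + l * y i)
      (fun i => velocity (fun t i => x t i + l * y i) i s)
      = kinetic m 0 0 (fun i => velocity x i s) := by
    simp [kinetic, hv]
  refine add_le_add (ENNReal.ofReal_le_ofReal h.le) (add_le_add (add_le_add ?_ ?_) ?_)
  · exact H₁ l ((le_max_left _ _).trans hl) _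
  · exact H₂ l ((le_max_left _ _).trans ((le_max_right _ _).trans hl)) _
  · exact H₃ l ((le_max_right _ _).trans ((le_max_right _ _).trans hl)) _

/-- The `H¹` norm bounds the minimal distance of a body from the origin, as the period `2π` is at
least `1`. -/
theorem le_h1Norm {m : Fin 3 → ℝ} {x : Circle → Fin 3 → ℂ} (hx : x ∈ loopSpace m) {R : ℝ}
    (hR : 0 ≤ R) (i : Fin 3) (h : ∀ t, R ≤ ‖x t i‖) : R ≤ h1Norm x := by
  have hint (j : Fin 3) : IntervalIntegrable
      (fun s => ‖x (Circle.exp s) j‖ ^ 2 + ‖velocity x j s‖ ^ 2) volume 0 (2 * Real.pi) := by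
    refine IntervalIntegrable.add (Continuous.intervalIntegrable ?_ _ _) ?_
    · exact (((continuous_of_mem_loopSpace hx j).comp Circle.exp.continuous).norm).pow 2
    · rw [intervalIntegrable_iff_integrableOn_Ioc_of_le Real.two_pi_pos.le]
      exact (hx.2 j).2.integrable_norm_pow two_ne_zero
  refine Real.le_sqrt_of_sq_le ?_
  refine le_trans ?_ (Finset.single_le_sum
    (f := fun j => ∫ s in (0 : ℝ)..(2 * Real.pi), (‖x (Circle.exp s) j‖ ^ 2 + ‖velocity x j s‖ ^ 2))
    (fun j _ => intervalIntegral.integral_nonneg Real.two_pi_pos.le fun s _ => by positivity)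
    (Finset.mem_univ i))
  have h1 : ∫ _ in (0 : ℝ)..(2 * Real.pi), R ^ 2 ≤
      ∫ s in (0 : ℝ)..(2 * Real.pi), (‖x (Circle.exp s) i‖ ^ 2 + ‖velocity x i s‖ ^ 2) :=
    intervalIntegral.integral_mono_on Real.two_pi_pos.le (by simp) (hint i) fun s _ => by
      have := pow_le_pow_left₀ hR (h (Circle.exp s)) 2
      linarith [sq_nonneg ‖velocity x i s‖]
  refine le_trans ?_ h1
  rw [intervalIntegral.integral_const, smul_eq_mul, sub_zero]
  nlinarith [Real.pi_gt_three, sq_nonneg R]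

namespace SymmetryAction

variable {G : Type*} [Group G] {m : Fin 3 → ℝ}

theorem apply_of_mem_equivariantLoops {S : SymmetryAction G m} {x : Circle → Fin 3 → ℂ}
    (hx : x ∈ S.equivariantLoops) (g : G) (t : Circle) (i : Fin 3) :
    S.ρ g (x t i) = x (onCircle (S.τ g) t) (S.σ g i) := by
  have h := congrFun (congrFun (hx.2 g) (onCircle (S.τ g) t)) (S.σ g i)
  rw [← h, actLoop]
  have ht : onCircle (S.τ g⁻¹) (onCircle (S.τ g) t) = t := by
    apply Circle.ext
    rw [coe_onCircle, coe_onCircle, ← Function.comp_apply (f := S.τ g⁻¹),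
      ← LinearIsometryEquiv.coe_mul, ← map_mul, inv_mul_cancel, map_one]
    rfl
  rw [ht, ← Equiv.Perm.mul_apply, ← map_mul, inv_mul_cancel, map_one, Equiv.Perm.one_apply]

theorem add_mem_equivariantLoops {S : SymmetryAction G m} {x : Circle → Fin 3 → ℂ}
    (hx : x ∈ S.equivariantLoops) {y : Fin 3 → ℂ} (hy : ∑ i, (m i : ℂ) * y i = 0)
    (hfix : ∀ g i, S.ρ g (y i) = y (S.σ g i)) :
    (fun t i => x t i + y i) ∈ S.equivariantLoops := by
  refine ⟨add_mem_loopSpace hx.1 hy, fun g => ?_⟩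
  funext t i
  have h := congrFun (congrFun (hx.2 g) t) i
  rw [actLoop] at h ⊢
  rw [map_add, h, hfix, ← Equiv.Perm.mul_apply, ← map_mul, mul_inv_cancel, map_one,
    Equiv.Perm.one_apply]

/-- A coercive action that admits a collision-free loop `x` fixes no configuration `y ≠ 0`:
otherwise the loops `x + l y` have bounded action, and they are unbounded. -/
theorem Coercive.eq_zero {S : SymmetryAction G m} {α : ℝ} (hα : 0 < α) (hS : S.Coercive α)
    {x : Circle → Fin 3 → ℂ} (hx : x ∈ S.equivariantLoops) (hcol : ¬ HasCollision x)
    {y : Fin 3 → ℂ} (hy : ∑ i, (m i : ℂ) * y i = 0)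
    (hfix : ∀ g i, S.ρ g (y i) = y (S.σ g i)) : y = 0 := by
  by_contra hne
  obtain ⟨i, hi⟩ := Function.ne_iff.mp hne
  obtain ⟨C, l₀, hC⟩ := exists_action_le hα hx.1 hcol y
  obtain ⟨R, hR⟩ := hS (C + 1)
  obtain ⟨B, hB⟩ := exists_forall_norm_le hx.1
  have hpos : 0 < ‖y i‖ := norm_pos_iff.mpr hi
  set l := max l₀ (max 0 ((max R 0 + B) / ‖y i‖))
  have hl₀ : l₀ ≤ l := le_max_left _ _
  have hl : 0 ≤ l := (le_max_left _ _).trans (le_max_right _ _)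
  have hl₁ : max R 0 + B ≤ l * ‖y i‖ :=
    (div_le_iff₀ hpos).mp ((le_max_right _ _).trans (le_max_right _ _))
  have hmem : (fun t i => x t i + l * y i) ∈ S.equivariantLoops := by
    refine add_mem_equivariantLoops (y := fun i => l * y i) hx ?_ fun g i => ?_
    · simp only [mul_left_comm _ (l : ℂ), ← Finset.mul_sum, hy, mul_zero]
    · rw [← hfix, ← Complex.real_smul, map_smul, Complex.real_smul]
  have hnorm : max R 0 ≤ h1Norm fun t i => x t i + l * y i := by
    refine le_h1Norm hmem.1 (le_max_right _ _) i fun t => ?_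
    have h1 : ‖(l : ℂ) * y i‖ = l * ‖y i‖ := by
      rw [norm_mul, Complex.norm_real, Real.norm_of_nonneg hl]
    have h2 := norm_sub_le_norm_add (l * y i) (x t i)
    rw [add_comm (x t i)]
    linarith [hB t i]
  have h := (hR _ hmem ((le_max_left _ _).trans hnorm)).trans (hC l hl₀)
  rw [ENNReal.coe_le_coe] at h
  exact absurd h (by simp)

end SymmetryAction

/-! ### The core of the action -/

theorem onCircle_mul (f g : O2) (t : Circle) :
    onCircle (f * g) t = onCircle f (onCircle g t) := rfl

theorem onCircle_one (t : Circle) : onCircle 1 t = t := rfl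

theorem reflection_apply_mul {f : O2} (hf : det2 f ≠ 1) (v c : ℂ) :
    f (v * c) = f v * (starRingEnd ℂ) c := by
  obtain ⟨a, rfl⟩ := exists_eq_rotation_mul_refl hf
  change (a : ℂ) * (starRingEnd ℂ) (v * c) = a * (starRingEnd ℂ) v * (starRingEnd ℂ) c
  rw [map_mul, mul_assoc]

/-- A reflection has two eigenlines: a vector on the same eigenline as `v` that is orthogonal to
`v` vanishes. -/
theorem re_div_ne_zero {f : O2} (hf : det2 f ≠ 1) {v w : ℂ} (hv : v ≠ 0) (hw : w ≠ 0)
    (h : (f v = v ∧ f w = w) ∨ (f v = -v ∧ f w = -w)) : (w / v).re ≠ 0 := by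
  have h₁ := reflection_apply_mul hf v (w / v)
  rw [mul_div_cancel₀ _ hv] at h₁
  have h₂ : (starRingEnd ℂ) (w / v) = w / v := by
    rcases h with ⟨h, h'⟩ | ⟨h, h'⟩
    · rw [h, h'] at h₁
      exact (eq_div_iff hv).mpr (by rw [mul_comm, ← h₁])
    · rw [h, h', neg_mul, neg_inj] at h₁
      exact (eq_div_iff hv).mpr (by rw [mul_comm, ← h₁])
  obtain ⟨r, hr⟩ := Complex.conj_eq_iff_real.mp h₂
  rw [hr, Complex.ofReal_re]
  rintro rfl
  rw [Complex.ofReal_zero, div_eq_zero_iff] at hr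
  exact hr.elim hw hv

theorem sum_ne_zero_of_continuous {X ι : Type*} [TopologicalSpace X] [PreconnectedSpace X]
    [Fintype ι] [Nonempty ι] {f : X → ℝ} (hf : Continuous f) (h₀ : ∀ t, f t ≠ 0) (p : ι → X) :
    ∑ i, f (p i) ≠ 0 := by
  have h : (∀ t, 0 < f t) ∨ ∀ t, f t < 0 := by
    by_contra! hcon
    obtain ⟨⟨a, ha⟩, b, hb⟩ := hcon
    obtain ⟨t, ht⟩ := mem_range_of_exists_le_of_exists_ge hf ⟨a, ha⟩ ⟨b, hb⟩
    exact h₀ t ht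
  rcases h with h | h
  · exact (Finset.sum_pos (fun i _ => h (p i)) Finset.univ_nonempty).ne'
  · exact (Finset.sum_neg (fun i _ => h (p i)) Finset.univ_nonempty).ne

namespace SymmetryAction

variable {G : Type*} [Group G] {m : Fin 3 → ℝ} {S : SymmetryAction G m}
  {x : Circle → Fin 3 → ℂ}

theorem apply_of_onCircle_eq (hx : x ∈ S.equivariantLoops) {g : G} {t : Circle}
    (h : onCircle (S.τ g) t = t) (i : Fin 3) : S.ρ g (x t i) = x t (S.σ g i) := by
  rw [apply_of_mem_equivariantLoops hx, h]

theorem sigma_eq_one_of_rho_eq_one (hx : x ∈ S.equivariantLoops) (hcol : ¬ HasCollision x)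
    {g : G} {t : Circle} (h : onCircle (S.τ g) t = t) (hg : S.ρ g = 1) : S.σ g = 1 := by
  by_contra hne
  obtain ⟨i, hi⟩ : ∃ i, S.σ g i ≠ i := by
    by_contra! hcon
    exact hne (Equiv.ext hcon)
  refine hcol ⟨t, S.σ g i, i, hi, ?_⟩
  rw [← apply_of_onCircle_eq hx h, hg]
  rfl

theorem sigma_ne_one_of_rho_eq_rotation (hx : x ∈ S.equivariantLoops) (hcol : ¬ HasCollision x)
    {g : G} {t : Circle} (h : onCircle (S.τ g) t = t) {a : Circle} (ha : a ≠ 1)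
    (hg : S.ρ g = rotation a) : S.σ g ≠ 1 := by
  intro hσ
  have h₀ (i : Fin 3) : x t i = 0 := by
    have h₁ := apply_of_onCircle_eq hx h i
    rw [hg, hσ, Equiv.Perm.one_apply, rotation_apply, mul_left_eq_self₀] at h₁
    exact h₁.resolve_left fun h₂ => ha (Circle.coe_eq_one.mp h₂)
  exact hcol ⟨t, 0, 1, by decide, by rw [h₀, h₀]⟩

/-- If a nontrivial rotation and a nontrivial permutation preserve the configuration at each
instant, the configuration is a symmetric pair about the third body at the origin, or an
equilateral triangle. -/
theorem homographic_of_core_rotation {g : G} (hτ : S.τ g = 1) {a : Circle} (ha : a ≠ 1)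
    (hρ : S.ρ g = rotation a) (hσ : S.σ g ≠ 1) : S.Homographic := by
  obtain ⟨i₀, hi₀⟩ : ∃ i, S.σ g i ≠ i := by
    by_contra! hcon
    exact hσ (Equiv.ext hcon)
  intro x hx
  have h (t i) : a * x t i = x t (S.σ g i) := by
    rw [← apply_of_onCircle_eq hx (by rw [hτ, onCircle_one]), hρ, rotation_apply]
  refine ⟨fun i => if i = i₀ then 1 else if i = S.σ g i₀ then (a : ℂ) else
    if S.σ g i = i then 0 else (a : ℂ) ^ 2, fun t => x t i₀, fun t i => ?_⟩
  dsimp only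
  split_ifs with h₁ h₂ h₃
  · rw [h₁, mul_one]
  · rw [h₂, ← h, mul_comm]
  · have h₄ := h t i
    rw [h₃, mul_left_eq_self₀] at h₄
    rw [mul_zero]
    exact h₄.resolve_left fun h₅ => ha (Circle.coe_eq_one.mp h₅)
  · have h₄ : ∀ (s : Perm3) (i i₀ : Fin 3), s i₀ ≠ i₀ → i ≠ i₀ → i ≠ s i₀ → s i ≠ i →
        s (s i₀) = i := by decide
    rw [← h₄ (S.σ g) i i₀ hi₀ h₁ h₂ h₃, ← h, ← h]
    ring

/-- A core element that acts on the plane as a reflection forces the three bodies to stay on a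
line, or two of them to stay symmetric about a line. Without collisions some difference
`x_i - x_j` then keeps its direction, and the sum of the configurations of the loop along a
`G`-orbit in time is a nonzero `G`-invariant configuration. -/
theorem not_coercive_of_core_reflection [Finite G] {α : ℝ} (hα : 0 < α)
    (hx : x ∈ S.equivariantLoops) (hcol : ¬ HasCollision x) {g : G} (hτ : S.τ g = 1)
    (hρ : det2 (S.ρ g) ≠ 1) : ¬ S.Coercive α := by
  intro hS
  have := Fintype.ofFinite G
  have h (t i) : S.ρ g (x t i) = x t (S.σ g i) :=
    apply_of_onCircle_eq hx (by rw [hτ, onCircle_one]) i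
  have hσ : S.σ g * S.σ g = 1 := by
    rw [← map_mul]
    refine sigma_eq_one_of_rho_eq_one hx hcol (t := 1) ?_ ?_
    · rw [map_mul, hτ, one_mul, onCircle_one]
    · rw [map_mul, mul_self_eq_one_of_det2_ne_one hρ]
  obtain ⟨u, hu, hu₁, hu₂⟩ := exists_axis hρ
  obtain ⟨i, j, v, hij, hv, hD⟩ : ∃ i j v, i ≠ j ∧ v ≠ 0 ∧ ∀ t,
      (S.ρ g v = v ∧ S.ρ g (x t i - x t j) = x t i - x t j) ∨
      (S.ρ g v = -v ∧ S.ρ g (x t i - x t j) = -(x t i - x t j)) := by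
    by_cases hσ₁ : S.σ g = 1
    · refine ⟨0, 1, u, by decide, hu, fun t => Or.inl ⟨hu₁, ?_⟩⟩
      rw [map_sub, h, h, hσ₁, Equiv.Perm.one_apply, Equiv.Perm.one_apply]
    · obtain ⟨i, j, hij, hs⟩ := Perm3.exists_eq_swap hσ₁ hσ
      refine ⟨i, j, Complex.I * u, hij, mul_ne_zero Complex.I_ne_zero hu,
        fun t => Or.inr ⟨hu₂, ?_⟩⟩
      rw [map_sub, h, h, hs, Equiv.swap_apply_left, Equiv.swap_apply_right, neg_sub]
  set y : Fin 3 → ℂ := fun i => ∑ k : G, x (onCircle (S.τ k) 1) i with hy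
  have hy₀ : y = 0 := by
    refine hS.eq_zero hα hx hcol ?_ fun k i => ?_
    · simp only [hy, Finset.mul_sum]
      rw [Finset.sum_comm]
      exact Finset.sum_eq_zero fun k _ => hx.1.1 _
    · simp only [hy, map_sum]
      refine Fintype.sum_equiv (Equiv.mulLeft k) _ _ fun l => ?_
      rw [apply_of_mem_equivariantLoops hx, Equiv.coe_mulLeft, map_mul, onCircle_mul]
  have hcont : Continuous fun t => ((x t i - x t j) / v).re := Complex.continuous_re.comp
    (((continuous_of_mem_loopSpace hx.1 i).sub (continuous_of_mem_loopSpace hx.1 j)).div_const v)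
  refine sum_ne_zero_of_continuous hcont
    (fun t => re_div_ne_zero hρ hv (fun h₀ => hcol ⟨t, i, j, hij, sub_eq_zero.mp h₀⟩) (hD t))
    (fun k : G => onCircle (S.τ k) 1) ?_
  have h₁ : ∑ k : G, ((x (onCircle (S.τ k) 1) i - x (onCircle (S.τ k) 1) j) / v).re
      = ((y i - y j) / v).re := by
    rw [← Complex.re_sum, ← Finset.sum_div, Finset.sum_sub_distrib]
  rw [h₁, hy₀]
  simp

/-- The core acts trivially: its rotations make the action homographic or force collisions, its
reflections make it fully uncoercive. -/
theorem trivialCore [Finite G] {α : ℝ} (hα : 0 < α) (hx : x ∈ S.equivariantLoops)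
    (hcol : ¬ HasCollision x) (hF : ¬ S.FullyUncoercive α) (hH : ¬ S.Homographic) :
    S.TrivialCore := by
  intro g hτ
  have ht : onCircle (S.τ g) 1 = 1 := by rw [hτ, onCircle_one]
  by_cases hρ : det2 (S.ρ g) = 1
  · obtain ⟨a, ha⟩ := exists_eq_rotation hρ
    by_cases ha₁ : a = 1
    · rw [ha₁, map_one] at ha
      exact ⟨ha, sigma_eq_one_of_rho_eq_one hx hcol ht ha⟩
    · exact absurd (homographic_of_core_rotation hτ ha₁ ha
        (sigma_ne_one_of_rho_eq_rotation hx hcol ht ha₁ ha)) hH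
  · exact absurd ⟨fun hR => hρ (by rw [hR, hτ, det2_one]),
      not_coercive_of_core_reflection hα hx hcol hτ hρ⟩ hF

/-! ### Choice of the rotating frame -/

/-- For a group of type R some rotating frame makes all time translations act trivially on the
plane. -/
theorem exists_rotatingFrame [Finite G] (hR : S.IsTypeR) (hS : S.TrivialCore) :
    ∃ ω : ℤ, (S.rotatingFrame hR ω).IsTypeR ∧ (S.rotatingFrame hR ω).TrivialCore ∧
      ∀ g, det2 (S.τ g) = 1 → (S.rotatingFrame hR ω).ρ g = 1 := by
  obtain ⟨N, hN, g₀, hg₀, hgen⟩ := exists_rot_generator S.τ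
  have hdet : det2 (S.ρ g₀) = 1 := by rw [hR, hg₀, rot, det2_rotation]
  obtain ⟨b, hb⟩ := exists_eq_rotation hdet
  have hbN : b ^ N = 1 := by
    have h := (hS (g₀ ^ N) (by rw [map_pow, hg₀, rot_pow_eq_one_iff hN])).1
    rw [map_pow, hb, ← map_pow, ← map_one rotation] at h
    exact rotation_injective h
  obtain ⟨k, rfl⟩ := exists_eq_circleExp_pow hN hbN
  have happ (ω : ℤ) (g : G) :
      (S.rotatingFrame hR ω).ρ g = rotation (shift (S.τ g) ^ (-ω)) * S.ρ g := rfl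
  have hcore (ω : ℤ) : (S.rotatingFrame hR ω).TrivialCore := fun g hg => by
    have hg' : S.τ g = 1 := hg
    refine ⟨?_, (hS g hg').2⟩
    rw [happ, hg', shift_one, one_zpow, map_one, one_mul, (hS g hg').1]
  refine ⟨k, fun g => ?_, hcore k, fun g hg => ?_⟩
  · rw [happ, det2_mul, det2_rotation, one_mul]
    exact hR g
  · obtain ⟨j, hj⟩ := hgen g hg
    have h₀ : (S.rotatingFrame hR k).ρ g₀ = 1 := by
      rw [happ, hg₀, hb, rot, shift_rotation, ← map_mul, zpow_neg, zpow_natCast, inv_mul_cancel,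
        map_one]
    have h₁ := (hcore k (g * (g₀ ^ j)⁻¹) (by
      change S.τ _ = 1
      rw [map_mul, map_inv, map_pow, hj, mul_inv_cancel])).1
    rwa [map_mul, map_inv, map_pow, h₀, one_pow, inv_one, mul_one] at h₁

end SymmetryAction

/-! ### Conjugation -/

theorem conjugated_closure_singleton {a a' : O2 × O2 × Perm3} (c : O2 × O2 × Perm3)
    (h : c * a * c⁻¹ = a') : Conjugated (Subgroup.closure {a}) (Subgroup.closure {a'}) := by
  refine ⟨c, ?_⟩
  rw [MonoidHom.map_closure, Set.image_singleton, ← h]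
  rfl

theorem conjugated_closure_pair {a b a' b' : O2 × O2 × Perm3} (c : O2 × O2 × Perm3)
    (ha : c * a * c⁻¹ = a') (hb : c * b * c⁻¹ = b') :
    Conjugated (Subgroup.closure {a, b}) (Subgroup.closure {a', b'}) := by
  refine ⟨c, ?_⟩
  rw [MonoidHom.map_closure, Set.image_pair, ← ha, ← hb]
  rfl

theorem rot_conj (θ : ℝ) (b : Circle) : rotation b * rot θ * (rotation b)⁻¹ = rot θ :=
  rotation_conj _ b

theorem closure_pair_le {H : Type*} [Group H] {a b : H} {K : Subgroup H} (ha : a ∈ K)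
    (hb : b ∈ K) : Subgroup.closure {a, b} ≤ K := by
  rw [Subgroup.closure_le, Set.insert_subset_iff, Set.singleton_subset_iff]
  exact ⟨ha, hb⟩

theorem closure_singleton_le {H : Type*} [Group H] {a : H} {K : Subgroup H} (ha : a ∈ K) :
    Subgroup.closure {a} ≤ K := by
  rw [Subgroup.closure_le, Set.singleton_subset_iff]
  exact ha

theorem conj_one {H : Type*} [Group H] (b : H) : b * 1 * b⁻¹ = 1 := by
  rw [mul_one, mul_inv_cancel]

namespace SymmetryAction

variable {G : Type*} [Group G] {m : Fin 3 → ℝ} {S : SymmetryAction G m}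

/-! ### Groups of type R -/

/-- The groups of type R, seen in a frame where the time translations act trivially on the
plane: these are determined by the action on the bodies. -/
theorem exists_conjugated_of_isTypeR [Finite G] (hS : S.TrivialCore) (hR : S.IsTypeR)
    (hρ : ∀ g, det2 (S.τ g) = 1 → S.ρ g = 1) :
    ∃ name, Conjugated S.reducedGroup (tableGroup name) := by
  obtain ⟨N, hN, g₀, hg₀, hdet, hdvd, hgen⟩ := hS.exists_generator
  have hρ₀ := hρ g₀ hdet
  have hone (h : S.σ g₀ = 1) : S.reducedHom g₀ = 1 :=
    hS.reducedHom_eq_one ((hS.powHom_eq_one_iff g₀).mpr ⟨hdet, hρ₀, h⟩)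
  have hdvd' (k : ℕ) : N ∣ k ↔ S.σ g₀ ^ k = 1 := by
    rw [hdvd, hρ₀, one_pow, and_iff_right rfl]
  have htwo (h₁ : S.σ g₀ ≠ 1) (h₂ : S.σ g₀ * S.σ g₀ = 1) :
      powHom S.redundancy (S.τ g₀) = rot Real.pi := by
    have h : N = 2 := ((Nat.dvd_prime Nat.prime_two).mp
      ((hdvd' 2).mpr (by rw [sq, h₂]))).resolve_left fun h =>
        h₁ (by simpa using (hdvd' 1).mp (by rw [h]))
    rw [hg₀, h]
    congr 1
    push_cast
    ring
  have hthree (h₁ : S.σ g₀ ≠ 1) (h₃ : S.σ g₀ ^ 3 = 1) :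
      powHom S.redundancy (S.τ g₀) = rot (2 * Real.pi / 3) := by
    have h : N = 3 := ((Nat.dvd_prime Nat.prime_three).mp ((hdvd' 3).mpr h₃)).resolve_left
      fun h => h₁ (by simpa using (hdvd' 1).mp (by rw [h]))
    rw [hg₀, h]
    norm_num
  by_cases hrot : ∀ g, det2 (S.τ g) = 1
  · rw [reducedGroup_eq_closure_singleton hrot hgen]
    rcases Perm3.eq_one_or (S.σ g₀) with h₁ | ⟨h₁, h₂⟩ | ⟨h₁, h₂, h₃⟩
    · refine ⟨.trivial, 1, ?_⟩
      rw [hone h₁, Subgroup.closure_singleton_one, Subgroup.map_bot]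
      rfl
    · obtain ⟨p, hp⟩ := Perm3.exists_conj_eq_swap12 h₁ h₂
      exact ⟨.choreography21, conjugated_closure_singleton (rotation 1, rotation 1, p)
        (Prod.ext ((congrArg (_ * · * _) (htwo h₁ h₂)).trans (rot_conj _ _))
          (Prod.ext ((congrArg (_ * · * _) hρ₀).trans (conj_one _)) hp))⟩
    · obtain ⟨p, hp⟩ := Perm3.exists_conj_eq_cycle123 h₂ h₃
      exact ⟨.choreography3, conjugated_closure_singleton (rotation 1, rotation 1, p)
        (Prod.ext ((congrArg (_ * · * _) (hthree h₁ h₃)).trans (rot_conj _ _))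
          (Prod.ext ((congrArg (_ * · * _) hρ₀).trans (conj_one _)) hp))⟩
  · obtain ⟨h, hh⟩ := not_forall.mp hrot
    have hconj {h : G} (hh : det2 (S.τ h) ≠ 1) : ∃ b b',
        rotation b * powHom S.redundancy (S.τ h) * (rotation b)⁻¹ = refl ∧
        rotation b' * S.ρ h * (rotation b')⁻¹ = refl := by
      obtain ⟨b, hb⟩ := exists_conj_eq_refl (f := powHom S.redundancy (S.τ h))
        (by rwa [det2_powHom])
      obtain ⟨b', hb'⟩ := exists_conj_eq_refl (f := S.ρ h) (by rwa [hR])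
      exact ⟨b, b', hb, hb'⟩
    have hinv {h : G} (hh : det2 (S.τ h) ≠ 1) : S.σ h * S.σ h = 1 := (hS.mul_self_eq_one hh).2
    have hmul {h : G} (hh : det2 (S.τ h) ≠ 1) : det2 (S.τ (h * g₀)) ≠ 1 := by
      rw [map_mul]
      exact det2_mul_ne_one hh hdet
    rcases Perm3.eq_one_or (S.σ g₀) with h₁ | ⟨h₁, h₂⟩ | ⟨h₁, h₂, h₃⟩
    · rw [reducedGroup_eq_closure_pair hh hgen, hone h₁, Subgroup.closure_insert_one]
      obtain ⟨b, b', hb, hb'⟩ := hconj hh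
      by_cases hσ : S.σ h = 1
      · exact ⟨.line, conjugated_closure_singleton (rotation b, rotation b', 1)
          (Prod.ext hb (Prod.ext hb' ((congrArg (_ * · * _) hσ).trans (conj_one _))))⟩
      · obtain ⟨p, hp⟩ := Perm3.exists_conj_eq_swap12 hσ (hinv hh)
        exact ⟨.isosceles, conjugated_closure_singleton (rotation b, rotation b', p)
          (Prod.ext hb (Prod.ext hb' hp))⟩
    · -- Of the time reversals `h` and `h g₀`, one fixes the bodies.
      obtain ⟨h, hh, hσ⟩ : ∃ h, det2 (S.τ h) ≠ 1 ∧ S.σ h = 1 := by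
        by_cases hσ : S.σ h = 1
        · exact ⟨h, hh, hσ⟩
        · refine ⟨h * g₀, hmul hh, ?_⟩
          have h₄ := hinv (hmul hh)
          rw [map_mul] at h₄ ⊢
          exact Perm3.mul_eq_one_of_involutions h₁ h₂ hσ (hinv hh) h₄
      rw [reducedGroup_eq_closure_pair hh hgen]
      obtain ⟨b, b', hb, hb'⟩ := hconj hh
      obtain ⟨p, hp⟩ := Perm3.exists_conj_eq_swap12 h₁ h₂
      exact ⟨.hill, conjugated_closure_pair (rotation b, rotation b', p)
        (Prod.ext ((congrArg (_ * · * _) (htwo h₁ h₂)).trans (rot_conj _ _))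
          (Prod.ext ((congrArg (_ * · * _) hρ₀).trans (conj_one _)) hp))
        (Prod.ext hb (Prod.ext hb' ((congrArg (_ * · * _) hσ).trans (conj_one _))))⟩
    · rw [reducedGroup_eq_closure_pair hh hgen]
      obtain ⟨b, b', hb, hb'⟩ := hconj hh
      have h₄ := hinv (hmul hh)
      rw [map_mul] at h₄
      obtain ⟨p, hp, hp'⟩ := Perm3.exists_conj_eq_cycle123_and_swap12 ⟨h₂, h₃⟩ ⟨hinv hh, h₄⟩
      exact ⟨.lagrange, conjugated_closure_pair (rotation b, rotation b', p)
        (Prod.ext ((congrArg (_ * · * _) (hthree h₁ h₃)).trans (rot_conj _ _))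
          (Prod.ext ((congrArg (_ * · * _) hρ₀).trans (conj_one _)) hp))
        (Prod.ext hb (Prod.ext hb' hp'))⟩

end SymmetryAction

/-! ### Invariant collinear configurations -/

/-- The collinear configuration with coordinates `w` on the line spanned by `u`. -/
def lineConfig (w : Fin 3 → ℝ) (u : ℂ) : Fin 3 → ℂ := fun i => w i * u

/-- The coordinates of the configuration with two opposite bodies `i` and `j`, and the third body
at the origin. -/
def pairCoord (i j : Fin 3) : Fin 3 → ℝ := Pi.single i 1 - Pi.single j 1

/-- The coordinates of the configuration with the third body at the origin, and the first two on
opposite sides so that the centre of mass is at the origin. -/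
def balancedCoord (m : Fin 3 → ℝ) : Fin 3 → ℝ := ![m 1, -m 0, 0]

theorem pairCoord_swap (i j k : Fin 3) : pairCoord i j (Equiv.swap i j k) = -pairCoord i j k := by
  simp only [pairCoord, Pi.sub_apply, Pi.single_apply, Equiv.swap_apply_def]
  split_ifs <;> simp_all

theorem map_mul_of_real (f : O2) (r : ℝ) (u : ℂ) : f (r * u) = r * f u := by
  rw [← Complex.real_smul, map_smul, Complex.real_smul]

/-- The elements of `O(2) × O(2) × Σ₃` that preserve a configuration, moving and relabelling
its bodies. -/
def configStabilizer (y : Fin 3 → ℂ) : Subgroup (O2 × O2 × Perm3) where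
  carrier := {p | ∀ i, p.2.1 (y i) = y (p.2.2 i)}
  one_mem' _ := rfl
  mul_mem' {p q} hp hq i := by
    change p.2.1 (q.2.1 (y i)) = y (p.2.2 (q.2.2 i))
    rw [hq, hp]
  inv_mem' {p} hp i := by
    change p.2.1.symm (y i) = y (p.2.2.symm i)
    rw [LinearIsometryEquiv.symm_apply_eq, hp, Equiv.apply_symm_apply]

namespace SymmetryAction

variable {G : Type*} [Group G] {m : Fin 3 → ℝ} {S : SymmetryAction G m}
  {x : Circle → Fin 3 → ℂ}

theorem Coercive.lineConfig_eq_zero {α : ℝ} (hα : 0 < α) (hS : S.Coercive α)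
    (hx : x ∈ S.equivariantLoops) (hcol : ¬ HasCollision x) {w : Fin 3 → ℝ} {u : ℂ}
    (hw : ∑ i, m i * w i = 0) (hfix : S.reducedGroup ≤ configStabilizer (lineConfig w u)) :
    lineConfig w u = 0 := by
  refine hS.eq_zero hα hx hcol ?_ fun g i => hfix (⟨g, rfl⟩ : S.reducedHom g ∈ S.reducedGroup) i
  simp only [lineConfig, ← mul_assoc, ← Finset.sum_mul]
  have h := congrArg Complex.ofReal hw
  push_cast at h
  rw [h, zero_mul]

theorem Coercive.not_le_stabilizer_balanced (hm : ∀ i, 0 < m i) {α : ℝ} (hα : 0 < α)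
    (hS : S.Coercive α) (hx : x ∈ S.equivariantLoops) (hcol : ¬ HasCollision x) {u : ℂ}
    (hu : u ≠ 0) : ¬ S.reducedGroup ≤ configStabilizer (lineConfig (balancedCoord m) u) := by
  intro hfix
  have h := congrFun (hS.lineConfig_eq_zero hα hx hcol
    (by simp [balancedCoord, Fin.sum_univ_three, mul_comm]) hfix) 0
  exact mul_ne_zero (Complex.ofReal_ne_zero.mpr (hm 1).ne') hu h

theorem Coercive.not_le_stabilizer_pair {α : ℝ} (hα : 0 < α)
    (hS : S.Coercive α) (hx : x ∈ S.equivariantLoops) (hcol : ¬ HasCollision x) {u : ℂ}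
    (hu : u ≠ 0) {i j : Fin 3} (hij : i ≠ j) {g : G} (hg : S.σ g = Equiv.swap i j) :
    ¬ S.reducedGroup ≤ configStabilizer (lineConfig (pairCoord i j) u) := by
  intro hfix
  have hm : m j = m i := by rw [← S.mass_eq g i, hg, Equiv.swap_apply_left]
  have h := congrFun (hS.lineConfig_eq_zero hα hx hcol
    (by simp [pairCoord, mul_sub, Pi.single_apply, hm]) hfix) i
  simp [lineConfig, pairCoord, hij, hu] at h

theorem mem_configStabilizer_of_eq {g : G} {w : Fin 3 → ℝ} {u : ℂ} (hρ : S.ρ g u = u)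
    (hσ : S.σ g = 1) : S.reducedHom g ∈ configStabilizer (lineConfig w u) := fun i => by
  change S.ρ g (w i * u) = w (S.σ g i) * u
  rw [map_mul_of_real, hρ, hσ, Equiv.Perm.one_apply]

theorem mem_configStabilizer_of_eq_neg {g : G} {i j : Fin 3} {u : ℂ} (hρ : S.ρ g u = -u)
    (hσ : S.σ g = Equiv.swap i j) :
    S.reducedHom g ∈ configStabilizer (lineConfig (pairCoord i j) u) := fun k => by
  change S.ρ g (pairCoord i j k * u) = pairCoord i j (S.σ g k) * u
  rw [map_mul_of_real, hρ, hσ, pairCoord_swap, Complex.ofReal_neg, neg_mul, mul_neg]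

/-! ### Coercive groups that are not of type R -/

/-- At an instant fixed by a time reversal `h` that acts on the plane by `±1`, the absence of
collisions forces the action of `h` on the bodies to be trivial for the sign `+`, nontrivial for
the sign `-`. -/
theorem reversal_alternative (hx : x ∈ S.equivariantLoops) (hcol : ¬ HasCollision x)
    (hS : S.TrivialCore) {h : G} (hh : det2 (S.τ h) ≠ 1) (hρ : det2 (S.ρ h) = 1) :
    (S.ρ h = 1 ∧ S.σ h = 1) ∨ (S.ρ h = rotation (-1) ∧ S.σ h ≠ 1) := by
  obtain ⟨t, ht⟩ := exists_onCircle_eq hh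
  rcases rotation_eq_one_or_of_mul_self hρ (hS.mul_self_eq_one hh).1 with h₁ | h₁
  · exact Or.inl ⟨h₁, sigma_eq_one_of_rho_eq_one hx hcol ht h₁⟩
  · exact Or.inr ⟨h₁, sigma_ne_one_of_rho_eq_rotation hx hcol ht (Circle.neg_ne_self 1) h₁⟩

/-- The coercive groups whose time translations include a reflection of the plane. -/
theorem exists_conjugated_of_translation_reflection [Finite G] (hm : ∀ i, 0 < m i) {α : ℝ}
    (hα : 0 < α) (hc : S.Coercive α) (hx : x ∈ S.equivariantLoops) (hcol : ¬ HasCollision x)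
    (hS : S.TrivialCore) {N : ℕ} {g₀ : G}
    (hg₀ : powHom S.redundancy (S.τ g₀) = rot (2 * Real.pi / N)) (hdet : det2 (S.τ g₀) = 1)
    (hdvd : ∀ k : ℕ, N ∣ k ↔ S.ρ g₀ ^ k = 1 ∧ S.σ g₀ ^ k = 1)
    (hgen : ∀ g, det2 (S.τ g) = 1 → ∃ k : ℕ, S.reducedHom g = S.reducedHom g₀ ^ k)
    (hρ₀ : det2 (S.ρ g₀) ≠ 1) :
    ∃ name, Conjugated S.reducedGroup (tableGroup name) := by
  have hsq := mul_self_eq_one_of_det2_ne_one hρ₀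
  have hsix (h₂ : S.σ g₀ * S.σ g₀ ≠ 1) (h₃ : S.σ g₀ ^ 3 = 1) :
      powHom S.redundancy (S.τ g₀) = rot (Real.pi / 3) := by
    have d₆ : N ∣ 6 := (hdvd 6).mpr
      ⟨by rw [show 6 = 2 * 3 from rfl, pow_mul, sq, hsq, one_pow],
        by rw [show 6 = 3 * 2 from rfl, pow_mul, h₃, one_pow]⟩
    have d₂ : ¬ N ∣ 2 := fun h => h₂ (by rw [← sq]; exact ((hdvd 2).mp h).2)
    have d₃ : ¬ N ∣ 3 := fun h => hρ₀ (by
      have h' := ((hdvd 3).mp h).1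
      rw [pow_succ, sq, hsq, one_mul] at h'
      rw [h', det2_one])
    have hle := Nat.le_of_dvd (by norm_num) d₆
    have h : N = 6 := by interval_cases N <;> omega
    rw [hg₀, h]
    congr 1
    push_cast
    ring
  obtain ⟨u, hu, hu₁, hu₂⟩ := exists_axis hρ₀
  have hu' : Complex.I * u ≠ 0 := mul_ne_zero Complex.I_ne_zero hu
  obtain ⟨b', hb'⟩ := exists_conj_eq_refl hρ₀
  by_cases hrot : ∀ g, det2 (S.τ g) = 1
  · have hcl := reducedGroup_eq_closure_singleton hrot hgen
    rcases Perm3.eq_one_or (S.σ g₀) with h₁ | ⟨h₁, h₂⟩ | ⟨-, h₂, h₃⟩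
    · exact absurd (hcl ▸ closure_singleton_le (mem_configStabilizer_of_eq hu₁ h₁))
        (hc.not_le_stabilizer_balanced hm hα hx hcol hu)
    · obtain ⟨i, j, hij, hs⟩ := Perm3.exists_eq_swap h₁ h₂
      exact absurd (hcl ▸ closure_singleton_le (mem_configStabilizer_of_eq_neg hu₂ hs))
        (hc.not_le_stabilizer_pair hα hx hcol hu' hij hs)
    · obtain ⟨p, hp⟩ := Perm3.exists_conj_eq_cycle123 h₂ h₃
      rw [hcl]
      exact ⟨.c6, conjugated_closure_singleton (rotation 1, rotation b', p)
        (Prod.ext ((congrArg (_ * · * _) (hsix h₂ h₃)).trans (rot_conj _ _)) (Prod.ext hb' hp))⟩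
  · -- Of the time reversals `h` and `h g₀`, one acts on the plane as a rotation.
    obtain ⟨h, hh, hρ⟩ : ∃ h, det2 (S.τ h) ≠ 1 ∧ det2 (S.ρ h) = 1 := by
      obtain ⟨h, hh⟩ := not_forall.mp hrot
      by_cases hρ : det2 (S.ρ h) = 1
      · exact ⟨h, hh, hρ⟩
      · refine ⟨h * g₀, ?_, ?_⟩
        · rw [map_mul]
          exact det2_mul_ne_one hh hdet
        · rw [map_mul]
          exact det2_mul_eq_one hρ hρ₀
    have hcl := reducedGroup_eq_closure_pair hh hgen
    have hinv := (hS.mul_self_eq_one hh).2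
    have hinv' : (S.σ h * S.σ g₀) * (S.σ h * S.σ g₀) = 1 := by
      rw [← map_mul S.σ h g₀]
      refine (hS.mul_self_eq_one ?_).2
      rw [map_mul]
      exact det2_mul_ne_one hh hdet
    have hneg {z : ℂ} (h' : S.ρ h = rotation (-1)) : S.ρ h z = -z := by
      rw [h', rotation_neg_one_apply]
    have hid {z : ℂ} (h' : S.ρ h = 1) : S.ρ h z = z := by
      rw [h']
      rfl
    rcases Perm3.eq_one_or (S.σ g₀) with h₁ | ⟨h₁, h₂⟩ | ⟨-, h₂, h₃⟩ <;>
      rcases reversal_alternative hx hcol hS hh hρ with ⟨hρh, hσh⟩ | ⟨hρh, hσh⟩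
    · exact absurd (hcl ▸ closure_pair_le (mem_configStabilizer_of_eq hu₁ h₁)
        (mem_configStabilizer_of_eq (hid hρh) hσh))
        (hc.not_le_stabilizer_balanced hm hα hx hcol hu)
    · obtain ⟨i, j, hij, hs⟩ := Perm3.exists_eq_swap hσh hinv
      exact absurd (hcl ▸ closure_pair_le (mem_configStabilizer_of_eq hu₁ h₁)
        (mem_configStabilizer_of_eq_neg (hneg hρh) hs))
        (hc.not_le_stabilizer_pair hα hx hcol hu hij hs)
    · obtain ⟨i, j, hij, hs⟩ := Perm3.exists_eq_swap h₁ h₂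
      exact absurd (hcl ▸ closure_pair_le (mem_configStabilizer_of_eq_neg hu₂ hs)
        (mem_configStabilizer_of_eq (hid hρh) hσh))
        (hc.not_le_stabilizer_pair hα hx hcol hu' hij hs)
    · obtain ⟨i, j, hij, hs⟩ := Perm3.exists_eq_swap h₁ h₂
      have hs' : S.σ h = Equiv.swap i j := by
        rw [← hs, mul_eq_one_iff_eq_inv.mp (Perm3.mul_eq_one_of_involutions h₁ h₂ hσh hinv hinv')]
        exact inv_eq_of_mul_eq_one_left h₂
      exact absurd (hcl ▸ closure_pair_le (mem_configStabilizer_of_eq_neg hu₂ hs)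
        (mem_configStabilizer_of_eq_neg (hneg hρh) hs'))
        (hc.not_le_stabilizer_pair hα hx hcol hu' hij hs)
    · rw [hσh, one_mul] at hinv'
      exact absurd hinv' h₂
    · obtain ⟨b, hb⟩ := exists_conj_eq_refl (f := powHom S.redundancy (S.τ h))
        (by rwa [det2_powHom])
      obtain ⟨p, hp, hp'⟩ := Perm3.exists_conj_eq_cycle123_and_swap12 ⟨h₂, h₃⟩ ⟨hinv, hinv'⟩
      rw [hcl]
      exact ⟨.d12, conjugated_closure_pair (rotation b, rotation b', p)
        (Prod.ext ((congrArg (_ * · * _) (hsix h₂ h₃)).trans (rot_conj _ _)) (Prod.ext hb' hp))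
        (Prod.ext hb (Prod.ext ((congrArg (_ * · * _) hρh).trans
          ((rotation_conj _ _).trans neg_eq_rotation.symm)) hp'))⟩

/-- The coercive groups, not of type R, whose time translations act on the plane by rotations. -/
theorem exists_conjugated_of_translation_rotation [Finite G] (hm : ∀ i, 0 < m i) {α : ℝ}
    (hα : 0 < α) (hc : S.Coercive α) (hx : x ∈ S.equivariantLoops) (hcol : ¬ HasCollision x)
    (hS : S.TrivialCore) (hR : ¬ S.IsTypeR) {N : ℕ} {g₀ : G}
    (hg₀ : powHom S.redundancy (S.τ g₀) = rot (2 * Real.pi / N)) (hdet : det2 (S.τ g₀) = 1)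
    (hdvd : ∀ k : ℕ, N ∣ k ↔ S.ρ g₀ ^ k = 1 ∧ S.σ g₀ ^ k = 1)
    (hgen : ∀ g, det2 (S.τ g) = 1 → ∃ k : ℕ, S.reducedHom g = S.reducedHom g₀ ^ k)
    (hρ₀ : det2 (S.ρ g₀) = 1) :
    ∃ name, Conjugated S.reducedGroup (tableGroup name) := by
  have htrans (g) (hg : det2 (S.τ g) = 1) : det2 (S.ρ g) = 1 := by
    obtain ⟨k, hk⟩ := hgen g hg
    have hk' : S.ρ g = S.ρ g₀ ^ k := congrArg (fun p : O2 × O2 × Perm3 => p.2.1) hk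
    rw [hk']
    exact det2_pow_eq_one hρ₀ k
  obtain ⟨h, hh, hρ⟩ : ∃ h, det2 (S.τ h) ≠ 1 ∧ det2 (S.ρ h) = 1 := by
    obtain ⟨h, hne⟩ := not_forall.mp hR
    have hh : det2 (S.τ h) ≠ 1 := fun h₁ => hne (by rw [htrans h h₁, h₁])
    refine ⟨h, hh, ?_⟩
    by_contra hρ
    exact hne (by rw [det2_eq_neg_one hρ, det2_eq_neg_one hh])
  have hmul {h : G} (hh : det2 (S.τ h) ≠ 1) : det2 (S.τ (h * g₀)) ≠ 1 := by
    rw [map_mul]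
    exact det2_mul_ne_one hh hdet
  have hmulρ {h : G} (hρ : det2 (S.ρ h) = 1) : det2 (S.ρ (h * g₀)) = 1 := by
    rw [map_mul, det2_mul, hρ, hρ₀, mul_one]
  have hne : rotation (-1) ≠ 1 := fun h₁ => by
    rw [← map_one rotation] at h₁
    exact Circle.neg_ne_self 1 (rotation_injective h₁)
  have hinv {h : G} (hh : det2 (S.τ h) ≠ 1) : S.σ h * S.σ h = 1 := (hS.mul_self_eq_one hh).2
  have hinv' {h : G} (hh : det2 (S.τ h) ≠ 1) :
      (S.σ h * S.σ g₀) * (S.σ h * S.σ g₀) = 1 := by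
    rw [← map_mul S.σ h g₀]
    exact hinv (hmul hh)
  -- Both `h` and `h g₀` act on the plane by `±1`, hence so does `g₀`.
  have hρ₀' : S.ρ g₀ = 1 ∨ S.ρ g₀ = rotation (-1) := by
    refine rotation_eq_one_or_of_mul_self hρ₀ ?_
    have e₁ := (hS.mul_self_eq_one (hmul hh)).1
    have e₂ := (hS.mul_self_eq_one hh).1
    obtain ⟨a, ha⟩ := exists_eq_rotation hρ₀
    obtain ⟨c, hc⟩ := exists_eq_rotation hρ
    rw [map_mul, ha, hc] at e₁
    rw [hc] at e₂
    rw [← map_mul, ← map_mul, mul_mul_mul_comm, map_mul, map_mul, e₂, one_mul] at e₁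
    rw [ha, ← map_mul]
    exact e₁
  have hone {g : G} {z : ℂ} (h' : S.ρ g = 1) : S.ρ g z = z := by
    rw [h']
    rfl
  have hneg {g : G} {z : ℂ} (h' : S.ρ g = rotation (-1)) : S.ρ g z = -z := by
    rw [h', rotation_neg_one_apply]
  rcases hρ₀' with hg | hg
  · have hcl := reducedGroup_eq_closure_pair hh hgen
    have alt := reversal_alternative hx hcol hS (hmul hh) (hmulρ hρ)
    rw [map_mul, map_mul, hg, mul_one] at alt
    rcases reversal_alternative hx hcol hS hh hρ with ⟨hρh, hσh⟩ | ⟨hρh, hσh⟩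
    · have hσ₀ : S.σ g₀ = 1 := by
        rcases alt with ⟨-, h₁⟩ | ⟨h₁, -⟩
        · rwa [hσh, one_mul] at h₁
        · exact absurd (h₁.symm.trans hρh) hne
      exact absurd (hcl ▸ closure_pair_le (mem_configStabilizer_of_eq (hone hg) hσ₀)
        (mem_configStabilizer_of_eq (hone hρh) hσh))
        (hc.not_le_stabilizer_balanced hm hα hx hcol one_ne_zero)
    · have hσ₁ : S.σ h * S.σ g₀ ≠ 1 := by
        rcases alt with ⟨h₁, -⟩ | ⟨-, h₁⟩
        · exact absurd (hρh.symm.trans h₁) hne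
        · exact h₁
      rcases Perm3.eq_one_or (S.σ g₀) with h₁ | ⟨h₁, h₂⟩ | ⟨h₁, h₂, h₃⟩
      · obtain ⟨i, j, hij, hs⟩ := Perm3.exists_eq_swap hσh (hinv hh)
        exact absurd (hcl ▸ closure_pair_le (mem_configStabilizer_of_eq (hone hg) h₁)
          (mem_configStabilizer_of_eq_neg (hneg hρh) hs))
          (hc.not_le_stabilizer_pair hα hx hcol one_ne_zero hij hs)
      · exact absurd (Perm3.mul_eq_one_of_involutions h₁ h₂ hσh (hinv hh) (hinv' hh)) hσ₁
      · have hN : N = 3 := by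
          refine ((Nat.dvd_prime Nat.prime_three).mp
            ((hdvd 3).mpr ⟨by rw [hg, one_pow], h₃⟩)).resolve_left fun h => h₁ ?_
          simpa using ((hdvd 1).mp (by rw [h])).2
        have hτ : powHom S.redundancy (S.τ g₀) = rot (Real.pi / 3) ^ 2 := by
          rw [hg₀, hN, rot, rot, ← map_pow, ← Circle.exp_nsmul]
          congr 2
          simp only [nsmul_eq_mul]
          push_cast
          ring
        obtain ⟨b, hb⟩ := exists_conj_eq_refl (f := powHom S.redundancy (S.τ h))
          (by rwa [det2_powHom])
        obtain ⟨p, hp, hp'⟩ :=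
          Perm3.exists_conj_eq_cycle123_sq_and_swap12 ⟨h₂, h₃⟩ ⟨hinv hh, hinv' hh⟩
        rw [hcl]
        refine ⟨.d6, conjugated_closure_pair (rotation b, rotation 1, p)
          (Prod.ext ((congrArg (_ * · * _) hτ).trans ?_)
            (Prod.ext ((congrArg (_ * · * _) hg).trans
              ((conj_one _).trans (refl_mul_refl.symm.trans (sq refl).symm))) hp))
          (Prod.ext hb (Prod.ext ((congrArg (_ * · * _) hρh).trans
            ((rotation_conj _ _).trans neg_eq_rotation.symm)) hp'))⟩
        rw [rot, ← map_pow]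
        exact (rotation_conj _ _).trans (map_pow _ _ _)
  · -- Of the time reversals `h` and `h g₀`, one acts trivially on the plane.
    obtain ⟨h, hh, hρh, hσh⟩ : ∃ h, det2 (S.τ h) ≠ 1 ∧ S.ρ h = 1 ∧ S.σ h = 1 := by
      rcases reversal_alternative hx hcol hS hh hρ with h₁ | ⟨h₁, -⟩
      · exact ⟨h, hh, h₁⟩
      · refine ⟨h * g₀, hmul hh, ?_⟩
        refine (reversal_alternative hx hcol hS (hmul hh) (hmulρ hρ)).resolve_right ?_
        rintro ⟨h₂, -⟩
        rw [map_mul, h₁, hg] at h₂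
        exact hne (mul_eq_left.mp h₂)
    have hcl := reducedGroup_eq_closure_pair hh hgen
    have hσ₀ : S.σ g₀ ≠ 1 := by
      have hρ' : S.ρ (h * g₀) = rotation (-1) := by rw [map_mul, hρh, one_mul, hg]
      have alt := reversal_alternative hx hcol hS (hmul hh) (by rw [hρ', det2_rotation])
      rw [hρ', map_mul, hσh, one_mul] at alt
      exact (alt.resolve_left fun h₁ => hne h₁.1).2
    have h₂ := hinv' hh
    rw [hσh, one_mul] at h₂
    obtain ⟨i, j, hij, hs⟩ := Perm3.exists_eq_swap hσ₀ h₂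
    exact absurd (hcl ▸ closure_pair_le (mem_configStabilizer_of_eq_neg (hneg hg) hs)
      (mem_configStabilizer_of_eq (hone hρh) hσh))
      (hc.not_le_stabilizer_pair hα hx hcol one_ne_zero hij hs)

end SymmetryAction
end ThreeBody

end

theorem mainTheorem1 (m : Fin 3 → ℝ) (hm : ∀ i, 0 < m i) (α : ℝ) (hα : 0 < α)
    {G : Type*} [Group G] [Finite G] (S : ThreeBody.SymmetryAction G m) :
    S.BoundToCollisions ∨ S.FullyUncoercive α ∨ S.Homographic ∨
      ∃ S' : ThreeBody.SymmetryAction G m, S.RotatingFrameChange S' ∧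
        ∃ name : ThreeBody.TableName,
          ThreeBody.Conjugated S'.reducedGroup (ThreeBody.tableGroup name) := by
  by_cases hB : S.BoundToCollisions
  · exact Or.inl hB
  by_cases hF : S.FullyUncoercive α
  · exact Or.inr (Or.inl hF)
  by_cases hH : S.Homographic
  · exact Or.inr (Or.inr (Or.inl hH))
  refine Or.inr (Or.inr (Or.inr ?_))
  obtain ⟨x, hx, hcol⟩ : ∃ x ∈ S.equivariantLoops, ¬ ThreeBody.HasCollision x := by
    unfold ThreeBody.SymmetryAction.BoundToCollisions at hB
    push Not at hB
    exact hB
  have hS := S.trivialCore hα hx hcol hF hH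
  by_cases hR : S.IsTypeR
  · obtain ⟨ω, hR', hS', hρ⟩ := S.exists_rotatingFrame hR hS
    exact ⟨_, Or.inr ⟨hR, ω, rfl⟩, ThreeBody.SymmetryAction.exists_conjugated_of_isTypeR hS' hR' hρ⟩
  · have hc : S.Coercive α := by
      by_contra hc
      exact hF ⟨hR, hc⟩
    refine ⟨S, Or.inl rfl, ?_⟩
    obtain ⟨N, -, g₀, hg₀, hdet, hdvd, hgen⟩ := hS.exists_generator
    by_cases hρ₀ : ThreeBody.det2 (S.ρ g₀) = 1
    · exact ThreeBody.SymmetryAction.exists_conjugated_of_translation_rotation hm hα hc hx hcol hS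
        hR hg₀ hdet hdvd hgen hρ₀
    · exact ThreeBody.SymmetryAction.exists_conjugated_of_translation_reflection hm hα hc hx hcol
        hS hg₀ hdet hdvd hgen hρ₀
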